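/- **Calculus.** Fix a set of operation symbols. The types of $\lambda_{\mathrm{eff}}^{+}$ are given by: value types $A,B ::= A\to C \mid \prod_{i=1}^n A_i \mid A+B$ ($n\ge 0$); computation types $C ::= A!\Sigma$; signatures $\Sigma$, i.e. finite sets $\{\mathtt{op}:A_{\mathtt{op}}\rightarrowtriangle B_{\mathtt{op}}\}$ with at most one entry per operation symbol (the order is irrelevant). Terms are considered with their typing and up to renaming of bound variables. * Value terms $V,W$: variables, $\lambda x.M$, $\langle V_1,\dots,V_n\rangle$, $\pi_i V$, $\iota_1V$, $\iota_2V$. * Computation terms $M,N$: $V\,W$, $\mathtt{return}\,V$, $\mathtt{let}\ x=M\ \mathtt{in}\ N$, $\mathtt{op}(V)$, $\mathtt{handle}\ M\ \mathtt{with}\ H\ \mathtt{to}\ x.N$, $\mathtt{case}\ V\ \{\iota_1x\mapsto M;\ \iota_2y\mapsto N\}$. * Handlers $H$: finite sets of clauses $\mathtt{op}(x,k)\mapsto M_{\mathtt{op}}$. The typing rules for variables, functions, tuples, projections and injections are the usual ones. For the others: $\Gamma\vdash\mathtt{return}\,V:A!\Sigma$ if $\Gamma\vdash V:A$; $\mathtt{let}$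 requires $M:A!\Sigma$ and $N:B!\Sigma$ with the same $\Sigma$ and has type $B!\Sigma$; $\Gamma\vdash\mathtt{op}(V):B_{\mathtt{op}}!\Sigma$ if $(\mathtt{op}:A_{\mathtt{op}}\rightarrowtriangle B_{\mathtt{op}})\in\Sigma$ and $\Gamma\vdash V:A_{\mathtt{op}}$; $\Gamma\vdash H:\Sigma\Rightarrow C$ if $H$ has exactly one clause for each $\mathtt{op}\in\Sigma$, with $\Gamma,x:A_{\mathtt{op}},k:B_{\mathtt{op}}\to C\vdash M_{\mathtt{op}}:C$; $\Gamma\vdash\mathtt{handle}\ M\ \mathtt{with}\ H\ \mathtt{to}\ x.N:C$ if $\Gamma\vdash M:A!\Sigma$, $\Gamma\vdash H:\Sigma\Rightarrow C$ and $\Gamma,x:A\vdash N:C$; $\Gamma\vdash\mathtt{case}\ V\ \{\iota_1x\mapsto M;\iota_2y\mapsto N\}:C$ if $\Gamma\vdash V:A+B$, $\Gamma,x:A\vdash M:C$ and $\Gamma,y:B\vdash N:C$. **Equations.** The judgements $\Gamma\vdash V=W:A$, $\Gamma\vdash M=N:C$ and $\Gamma\vdash H=H':\Sigma\Rightarrow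 C$ are the least congruence on typed terms containing the $\beta$- and $\eta$-laws for functions and finite products, the laws $$\mathtt{let}\ x=\mathtt{return}\,V\ \mathtt{in}\ M=M[V/x],\qquad \mathtt{let}\ x=M\ \mathtt{in}\ \mathtt{return}\,x=M,$$ $$\mathtt{let}\ y=(\mathtt{let}\ x=M\ \mathtt{in}\ N)\ \mathtt{in}\ L=\mathtt{let}\ x=M\ \mathtt{in}\ \mathtt{let}\ y=N\ \mathtt{in}\ L,$$ $$\mathtt{handle}\ (\mathtt{return}\,V)\ \mathtt{with}\ H\ \mathtt{to}\ x.M=M[V/x],$$ $$\mathtt{handle}\ (\mathtt{let}\ x=L\ \mathtt{in}\ M)\ \mathtt{with}\ H\ \mathtt{to}\ y.N=\mathtt{handle}\ L\ \mathtt{with}\ H\ \mathtt{to}\ x.(\mathtt{handle}\ M\ \mathtt{with}\ H\ \mathtt{to}\ y.N),$$ $$\mathtt{handle}\ \mathtt{op}(V)\ \mathtt{with}\ H\ \mathtt{to}\ x.M=M_{\mathtt{op}}[V/x,\lambda x.M/k]\quad\text{for }(\mathtt{op}(x,k)\mapsto M_{\mathtt{op}})\in H,$$ and, for sums, $$\mathtt{case}\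 \iota_iV\ \{\iota_1x\mapsto M_1;\ \iota_2x\mapsto M_2\}=M_i[V/x]\quad(i=1,2),$$ $$\mathtt{case}\ V\ \{\iota_1y\mapsto M[\iota_1y/x];\ \iota_2z\mapsto M[\iota_2z/x]\}=M[V/x].$$ **Models.** A *semantic signature* $S$ in a category $\mathcal C$ is a partial function with finite domain from operation symbols to pairs of objects, written $S=\{\mathtt{op}:A_{\mathtt{op}}\rightarrowtriangle B_{\mathtt{op}}\}$. A *$\lambda_{\mathrm{eff}}$-model* consists of: a category $\mathcal C$ with chosen finite products; for each semantic signature $S$, a strong monad $T_S=(T_S,\eta,\mu,\mathrm{st})$ on $\mathcal C$ with Kleisli exponentials $Y\Rightarrow_SZ$, i.e. bijections $\mathcal C(X\times Y,T_SZ)\cong\mathcal C(X,Y\Rightarrow_SZ)$ natural in $X$, with evaluation $\mathrm{ev}:(Y\Rightarrow_SZ)\times Y\to T_SZ$; morphisms $[\![\mathtt{op}]\!]_S:A_{\mathtt{op}}\to T_SB_{\mathtt{op}}$ for $(\mathtt{op}:A_{\mathtt{op}}\rightarrowtriangle B_{\mathtt{op}})\in S$; and, for all $S,S'$ and all objects $X$,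 a morphism $$\mathbf{handle}_{S,S',X}:\mathcal H\times T_ST_{S'}X\to T_{S'}X,\qquad \mathcal H=\mathcal H_{S,S',X}=\prod_{\mathtt{op}\in S}\bigl((A_{\mathtt{op}}\times(B_{\mathtt{op}}\Rightarrow_{S'}X))\Rightarrow_{S'}X\bigr),$$ such that $\mathbf{handle}\circ(\mathrm{id}\times\eta)=\pi_2$, $\mathbf{handle}\circ(\mathrm{id}\times\mu)=\mathbf{handle}\circ(\mathrm{id}\times T_S\mathbf{handle})\circ\langle\pi_1,\mathrm{st}\rangle$ and, for each $\mathtt{op}\in S$, $\mathbf{handle}\circ(\mathrm{id}\times a_{\mathtt{op}})=\mathrm{ev}\circ(\pi_{\mathtt{op}}\times\mathrm{id})$, where $a_{\mathtt{op}}=T_S\mathrm{ev}\circ\mathrm{st}\circ\langle\pi_2,\pi_1\rangle\circ([\![\mathtt{op}]\!]_S\times\mathrm{id}):A_{\mathtt{op}}\times(B_{\mathtt{op}}\Rightarrow_{S'}X)\to T_ST_{S'}X$. A diagram $X_1\xrightarrow{\iota_1}P\xleftarrow{\iota_2}X_2$ is a *Kleisli binary coproduct* for $T$ if for all $Y$ and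 $f_i:X_i\to TY$ there is a unique $h:P\to TY$ with $h\circ\iota_i=f_i$ ($i=1,2$); it is *distributive* if moreover $Z\times X_1\to Z\times P\leftarrow Z\times X_2$ is a Kleisli binary coproduct for $T$, for every $Z$. A *$\lambda_{\mathrm{eff}}^{+}$-model* is a $\lambda_{\mathrm{eff}}$-model with, for all $X_1,X_2$, a (chosen) diagram $X_1\to X_1+X_2\leftarrow X_2$ that is a distributive Kleisli binary coproduct for every $T_S$ simultaneously. **Interpretation.** In a $\lambda_{\mathrm{eff}}^{+}$-model, $[\![A\to B!\Sigma]\!]=[\![A]\!]\Rightarrow_{[\![\Sigma]\!]}[\![B]\!]$; product types, sum types and contexts are interpreted by the chosen products, Kleisli coproducts and products; signatures are interpreted componentwise. Terms are interpreted by induction on typing as morphisms $[\![V]\!]:[\![\Gamma]\!]\to[\![A]\!]$, $[\![M]\!]:[\![\Gamma]\!]\to T_{[\![\Sigma]\!]}[\![A]\!]$ (for $M:A!\Sigma$) and $[\![H]\!]:[\![\Gamma]\!]\to\mathcal H_{[\![\Sigma]\!],[\![\Sigma']\!],[\![B]\!]}$ (for $H:\Sigma\Rightarrow B!\Sigma'$).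 The fragment without handlers and sums is interpreted as usual for fine-grain call-by-value, and $[\![\mathtt{op}(V)]\!]=[\![\mathtt{op}]\!]\circ[\![V]\!]$. Further, $[\![H]\!]$ is the tuple of the curried clauses, $[\![\mathtt{handle}\ M\ \mathtt{with}\ H\ \mathtt{to}\ x.N]\!]=\mathbf{handle}\circ\langle[\![H]\!],\,T[\![N]\!]\circ\mathrm{st}\circ\langle\mathrm{id},[\![M]\!]\rangle\rangle$ with $T=T_{[\![\Sigma]\!]}$ for $M:A!\Sigma$, $[\![\iota_iV]\!]=\iota_i\circ[\![V]\!]$, and $[\![\mathtt{case}\ V\ \{\iota_1x\mapsto M;\iota_2y\mapsto N\}]\!]=[[\![M]\!],[\![N]\!]]\circ\langle\mathrm{id},[\![V]\!]\rangle$, where $[f,g]:[\![\Gamma]\!]\times([\![A]\!]+[\![B]\!])\to T_{[\![\Sigma']\!]}[\![D]\!]$ (for $M,N:D!\Sigma'$) is the unique morphism restricting to $f$ and $g$. **Proposition.** $\lambda_{\mathrm{eff}}^{+}$ is sound and complete with respect to $\lambda_{\mathrm{eff}}^{+}$-models: 1. (Soundness) If $\Gamma\vdash V=W:A$ is derivable,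 then $[\![V]\!]=[\![W]\!]$ in every $\lambda_{\mathrm{eff}}^{+}$-model. Likewise, derivability of $\Gamma\vdash M=N:C$ or of $\Gamma\vdash H=H':\Sigma\Rightarrow C$ implies $[\![M]\!]=[\![N]\!]$ or $[\![H]\!]=[\![H']\!]$, respectively, in every $\lambda_{\mathrm{eff}}^{+}$-model. 2. (Completeness) If $\Gamma\vdash V:A$ and $\Gamma\vdash W:A$ satisfy $[\![V]\!]=[\![W]\!]$ in every (small) $\lambda_{\mathrm{eff}}^{+}$-model, then $\Gamma\vdash V=W:A$ is derivable. The same holds for pairs of computation terms of the same type, and for pairs of handlers of the same type. -/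

import Mathlib

open CategoryTheory MonoidalCategory CartesianMonoidalCategory Limits

universe w u v

namespace LambdaEff

/-! ## Signatures, types and contexts -/

/-- A signature over `α`: a partial function with finite domain from operation symbols to pairs
(argument, result) of elements of `α`.  `Sig Op (VTy Op)` is the type of syntactic signatures,
`Sig Op C` (for a category `C`) the type of semantic signatures in `C`.  Two signatures with the
same operations and the same arities are equal; there is no order on the operations. -/
structure Sig (Op : Type w) (α : Type u) where
  dom : Finset Op
  arg : {o // o ∈ dom} → α
  res : {o // o ∈ dom} → α

/-- Apply a function to all argument and result types of a signature. -/
def Sig.map {Op : Type w} {α : Type u} {β : Type v} (f : α → β) (S : Sig Op α) : Sig Op β :=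
  ⟨S.dom, fun o => f (S.arg o), fun o => f (S.res o)⟩

/-- Value types `A → B ! Σ`, `∏_{i<n} Aᵢ` and `A + B`.  In the constructor for function types the
signature `Σ` of the computation type `B ! Σ` is unbundled into its three components. -/
inductive VTy (Op : Type w) : Type w
  | arrow (A : VTy Op) (dom : Finset Op) (arg res : {o // o ∈ dom} → VTy Op) (B : VTy Op) : VTy Op
  | prod {n : ℕ} (A : Fin n → VTy Op) : VTy Op
  | sum (A B : VTy Op) : VTy Op

/-- Computation types `A ! Σ`. -/
structure CTy (Op : Type w) where
  val : VTy Op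
  sig : Sig Op (VTy Op)

/-- The function type `A → C`. -/
abbrev VTy.fn {Op : Type w} (A : VTy Op) (C : CTy Op) : VTy Op :=
  .arrow A C.sig.dom C.sig.arg C.sig.res C.val

/-- Typing contexts; `A :: Γ` is the context `Γ, x : A`. -/
abbrev Ctx (Op : Type w) := List (VTy Op)

section Calculus

variable {Op : Type w}

/-! ## Terms

Well-typed terms with de Bruijn indices: an element of `Val Γ A` is a derivation of
`Γ ⊢ V : A`, up to renaming of bound variables. -/

/-- `Var Γ A`: the variables `x` with `(x : A) ∈ Γ`. -/
inductive Var : Ctx Op → VTy Op → Type w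
  | zero {Γ : Ctx Op} {A : VTy Op} : Var (A :: Γ) A
  | succ {Γ : Ctx Op} {A B : VTy Op} : Var Γ A → Var (B :: Γ) A

mutual

/-- Value terms `Γ ⊢ V : A`. -/
inductive Val : Ctx Op → VTy Op → Type w
  | var {Γ : Ctx Op} {A : VTy Op} (x : Var Γ A) : Val Γ A
  | lam {Γ : Ctx Op} {A : VTy Op} {C : CTy Op} (M : Comp (A :: Γ) C) : Val Γ (A.fn C)
  | tuple {Γ : Ctx Op} {n : ℕ} {A : Fin n → VTy Op} (V : ∀ i, Val Γ (A i)) : Val Γ (.prod A)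
  | proj {Γ : Ctx Op} {n : ℕ} {A : Fin n → VTy Op} (i : Fin n) (V : Val Γ (.prod A)) : Val Γ (A i)
  | inl {Γ : Ctx Op} {A B : VTy Op} (V : Val Γ A) : Val Γ (.sum A B)
  | inr {Γ : Ctx Op} {A B : VTy Op} (V : Val Γ B) : Val Γ (.sum A B)

/-- Computation terms `Γ ⊢ M : C`.  In `handle M H N` (handle `M` with `H` to `x. N`), `H` gives for
each operation `op : A_op ↠ B_op` of the handled signature `Σ` a clause `op(x, k) ↦ M_op` with
`Γ, x : A_op, k : B_op → C ⊢ M_op : C`. -/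
inductive Comp : Ctx Op → CTy Op → Type w
  | app {Γ : Ctx Op} {A : VTy Op} {C : CTy Op} (V : Val Γ (A.fn C)) (W : Val Γ A) : Comp Γ C
  | ret {Γ : Ctx Op} {A : VTy Op} {S : Sig Op (VTy Op)} (V : Val Γ A) : Comp Γ ⟨A, S⟩
  | letin {Γ : Ctx Op} {A B : VTy Op} {S : Sig Op (VTy Op)} (M : Comp Γ ⟨A, S⟩)
      (N : Comp (A :: Γ) ⟨B, S⟩) : Comp Γ ⟨B, S⟩
  | op {Γ : Ctx Op} {S : Sig Op (VTy Op)} (o : {o // o ∈ S.dom}) (V : Val Γ (S.arg o)) :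
      Comp Γ ⟨S.res o, S⟩
  | handle {Γ : Ctx Op} {A : VTy Op} {S : Sig Op (VTy Op)} {C : CTy Op} (M : Comp Γ ⟨A, S⟩)
      (H : ∀ o : {o // o ∈ S.dom}, Comp ((S.res o).fn C :: S.arg o :: Γ) C)
      (N : Comp (A :: Γ) C) : Comp Γ C
  | case {Γ : Ctx Op} {A B : VTy Op} {C : CTy Op} (V : Val Γ (.sum A B))
      (M : Comp (A :: Γ) C) (N : Comp (B :: Γ) C) : Comp Γ C

end

/-- Handlers `Γ ⊢ H : Σ ⇒ C`: a finite set of clauses, one for each operation in `Σ`. -/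
abbrev Hdl (Γ : Ctx Op) (S : Sig Op (VTy Op)) (C : CTy Op) : Type w :=
  ∀ o : {o // o ∈ S.dom}, Comp ((S.res o).fn C :: S.arg o :: Γ) C

/-! ## Renaming and substitution -/

/-- Renamings of the variables in `Γ` by variables in `Δ`. -/
abbrev Ren (Γ Δ : Ctx Op) : Type w := ∀ ⦃A : VTy Op⦄, Var Γ A → Var Δ A

def Ren.lift {Γ Δ : Ctx Op} (ρ : Ren Γ Δ) (B : VTy Op) : Ren (B :: Γ) (B :: Δ)
  | _, .zero => .zero
  | _, .succ x => .succ (ρ x)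

mutual

def Val.rename : {Γ Δ : Ctx Op} → {A : VTy Op} → Ren Γ Δ → Val Γ A → Val Δ A
  | _, _, _, ρ, .var x => .var (ρ x)
  | _, _, _, ρ, .lam M => .lam (M.rename (ρ.lift _))
  | _, _, _, ρ, .tuple V => .tuple fun i => (V i).rename ρ
  | _, _, _, ρ, .proj (A := A) i V => .proj (A := A) i (V.rename ρ)
  | _, _, _, ρ, .inl V => .inl (V.rename ρ)
  | _, _, _, ρ, .inr V => .inr (V.rename ρ)

def Comp.rename : {Γ Δ : Ctx Op} → {C : CTy Op} → Ren Γ Δ → Comp Γ C → Comp Δ C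
  | _, _, _, ρ, .app V W => .app (V.rename ρ) (W.rename ρ)
  | _, _, _, ρ, .ret V => .ret (V.rename ρ)
  | _, _, _, ρ, .letin M N => .letin (M.rename ρ) (N.rename (ρ.lift _))
  | _, _, _, ρ, .op o V => .op o (V.rename ρ)
  | _, _, _, ρ, .handle M H N =>
      .handle (M.rename ρ) (fun o => (H o).rename ((ρ.lift _).lift _)) (N.rename (ρ.lift _))
  | _, _, _, ρ, .case V M N => .case (V.rename ρ) (M.rename (ρ.lift _)) (N.rename (ρ.lift _))

end

/-- Weakening of a value term from `Γ` to `Γ, x : B`. -/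
def Val.weaken {Γ : Ctx Op} {A : VTy Op} (V : Val Γ A) (B : VTy Op) : Val (B :: Γ) A :=
  V.rename fun _ x => .succ x

/-- Weakening of a handler from `Γ` to `Γ, x : B`. -/
def Hdl.weaken {Γ : Ctx Op} {S : Sig Op (VTy Op)} {C : CTy Op} (H : Hdl Γ S C) (B : VTy Op) :
    Hdl (B :: Γ) S C :=
  fun o => (H o).rename (Ren.lift (Ren.lift (fun _ x => .succ x) _) _)

/-- Weakening of a computation term from `Γ, y : A` to `Γ, x : B, y : A`. -/
def Comp.weakenUnder {Γ : Ctx Op} {A : VTy Op} {C : CTy Op} (M : Comp (A :: Γ) C) (B : VTy Op) :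
    Comp (A :: B :: Γ) C :=
  M.rename (Ren.lift (fun _ x => .succ x) A)

/-- Substitutions of value terms in context `Δ` for the variables in `Γ`. -/
abbrev Subst (Γ Δ : Ctx Op) : Type w := ∀ ⦃A : VTy Op⦄, Var Γ A → Val Δ A

def Subst.lift {Γ Δ : Ctx Op} (σ : Subst Γ Δ) (B : VTy Op) : Subst (B :: Γ) (B :: Δ)
  | _, .zero => .var .zero
  | _, .succ x => (σ x).weaken B

/-- The identity substitution. -/
def Subst.id (Γ : Ctx Op) : Subst Γ Γ := fun _ x => .var x

/-- Extend a substitution by a value term for the last variable. -/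
def Subst.cons {Γ Δ : Ctx Op} {B : VTy Op} (σ : Subst Γ Δ) (V : Val Δ B) : Subst (B :: Γ) Δ
  | _, .zero => V
  | _, .succ x => σ x

mutual

def Val.subst : {Γ Δ : Ctx Op} → {A : VTy Op} → Subst Γ Δ → Val Γ A → Val Δ A
  | _, _, _, σ, .var x => σ x
  | _, _, _, σ, .lam M => .lam (M.subst (σ.lift _))
  | _, _, _, σ, .tuple V => .tuple fun i => (V i).subst σ
  | _, _, _, σ, .proj (A := A) i V => .proj (A := A) i (V.subst σ)
  | _, _, _, σ, .inl V => .inl (V.subst σ)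
  | _, _, _, σ, .inr V => .inr (V.subst σ)

def Comp.subst : {Γ Δ : Ctx Op} → {C : CTy Op} → Subst Γ Δ → Comp Γ C → Comp Δ C
  | _, _, _, σ, .app V W => .app (V.subst σ) (W.subst σ)
  | _, _, _, σ, .ret V => .ret (V.subst σ)
  | _, _, _, σ, .letin M N => .letin (M.subst σ) (N.subst (σ.lift _))
  | _, _, _, σ, .op o V => .op o (V.subst σ)
  | _, _, _, σ, .handle M H N =>
      .handle (M.subst σ) (fun o => (H o).subst ((σ.lift _).lift _)) (N.subst (σ.lift _))
  | _, _, _, σ, .case V M N => .case (V.subst σ) (M.subst (σ.lift _)) (N.subst (σ.lift _))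

end

/-- `M[V/x]` for `Γ, x : A ⊢ M : C` and `Γ ⊢ V : A`. -/
def Comp.inst {Γ : Ctx Op} {A : VTy Op} {C : CTy Op} (M : Comp (A :: Γ) C) (V : Val Γ A) :
    Comp Γ C :=
  M.subst ((Subst.id Γ).cons V)

/-- `M[V/x, W/k]` for `Γ, x : A, k : B ⊢ M : C`, `Γ ⊢ V : A` and `Γ ⊢ W : B`. -/
def Comp.inst₂ {Γ : Ctx Op} {A B : VTy Op} {C : CTy Op} (M : Comp (B :: A :: Γ) C)
    (V : Val Γ A) (W : Val Γ B) : Comp Γ C :=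
  M.subst (((Subst.id Γ).cons V).cons W)

/-- `M[V/x]` for `Γ, x : A ⊢ M : C` and `Γ, y : B ⊢ V : A`, a term in context `Γ, y : B`. -/
def Comp.replace {Γ : Ctx Op} {A B : VTy Op} {C : CTy Op} (M : Comp (A :: Γ) C)
    (V : Val (B :: Γ) A) : Comp (B :: Γ) C :=
  M.subst (Subst.cons (fun _ x => .var (.succ x)) V)

/-! ## The equational theory -/

mutual

/-- Derivability of `Γ ⊢ V = W : A`. -/
inductive ValEq : {Γ : Ctx Op} → {A : VTy Op} → Val Γ A → Val Γ A → Prop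
  | refl {Γ : Ctx Op} {A : VTy Op} (V : Val Γ A) : ValEq V V
  | symm {Γ : Ctx Op} {A : VTy Op} {V W : Val Γ A} : ValEq V W → ValEq W V
  | trans {Γ : Ctx Op} {A : VTy Op} {U V W : Val Γ A} : ValEq U V → ValEq V W → ValEq U W
  | lam_congr {Γ : Ctx Op} {A : VTy Op} {C : CTy Op} {M M' : Comp (A :: Γ) C} :
      CompEq M M' → ValEq (.lam M) (.lam M')
  | tuple_congr {Γ : Ctx Op} {n : ℕ} {A : Fin n → VTy Op} {V V' : ∀ i, Val Γ (A i)} :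
      (∀ i, ValEq (V i) (V' i)) → ValEq (.tuple V) (.tuple V')
  | proj_congr {Γ : Ctx Op} {n : ℕ} {A : Fin n → VTy Op} (i : Fin n) {V V' : Val Γ (.prod A)} :
      ValEq V V' → ValEq (.proj i V) (.proj i V')
  | inl_congr {Γ : Ctx Op} {A B : VTy Op} {V V' : Val Γ A} :
      ValEq V V' → ValEq (.inl (B := B) V) (.inl V')
  | inr_congr {Γ : Ctx Op} {A B : VTy Op} {V V' : Val Γ B} :
      ValEq V V' → ValEq (.inr (A := A) V) (.inr V')
  | lam_eta {Γ : Ctx Op} {A : VTy Op} {C : CTy Op} (V : Val Γ (A.fn C)) :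
      ValEq V (.lam (.app (V.weaken A) (.var .zero)))
  | prod_beta {Γ : Ctx Op} {n : ℕ} {A : Fin n → VTy Op} (V : ∀ i, Val Γ (A i)) (i : Fin n) :
      ValEq (.proj i (.tuple V)) (V i)
  | prod_eta {Γ : Ctx Op} {n : ℕ} {A : Fin n → VTy Op} (V : Val Γ (.prod A)) :
      ValEq V (.tuple fun i => .proj i V)

/-- Derivability of `Γ ⊢ M = N : C`. -/
inductive CompEq : {Γ : Ctx Op} → {C : CTy Op} → Comp Γ C → Comp Γ C → Prop
  | refl {Γ : Ctx Op} {C : CTy Op} (M : Comp Γ C) : CompEq M M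
  | symm {Γ : Ctx Op} {C : CTy Op} {M N : Comp Γ C} : CompEq M N → CompEq N M
  | trans {Γ : Ctx Op} {C : CTy Op} {L M N : Comp Γ C} : CompEq L M → CompEq M N → CompEq L N
  | app_congr {Γ : Ctx Op} {A : VTy Op} {C : CTy Op} {V V' : Val Γ (A.fn C)} {W W' : Val Γ A} :
      ValEq V V' → ValEq W W' → CompEq (.app V W) (.app V' W')
  | ret_congr {Γ : Ctx Op} {A : VTy Op} {S : Sig Op (VTy Op)} {V V' : Val Γ A} :
      ValEq V V' → CompEq (.ret (S := S) V) (.ret V')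
  | letin_congr {Γ : Ctx Op} {A B : VTy Op} {S : Sig Op (VTy Op)} {M M' : Comp Γ ⟨A, S⟩}
      {N N' : Comp (A :: Γ) ⟨B, S⟩} :
      CompEq M M' → CompEq N N' → CompEq (.letin M N) (.letin M' N')
  | op_congr {Γ : Ctx Op} {S : Sig Op (VTy Op)} (o : {o // o ∈ S.dom}) {V V' : Val Γ (S.arg o)} :
      ValEq V V' → CompEq (.op o V) (.op o V')
  | handle_congr {Γ : Ctx Op} {A : VTy Op} {S : Sig Op (VTy Op)} {C : CTy Op}
      {M M' : Comp Γ ⟨A, S⟩} {H H' : Hdl Γ S C} {N N' : Comp (A :: Γ) C} :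
      CompEq M M' → HdlEq H H' → CompEq N N' → CompEq (.handle M H N) (.handle M' H' N')
  | case_congr {Γ : Ctx Op} {A B : VTy Op} {C : CTy Op} {V V' : Val Γ (.sum A B)}
      {M M' : Comp (A :: Γ) C} {N N' : Comp (B :: Γ) C} :
      ValEq V V' → CompEq M M' → CompEq N N' → CompEq (.case V M N) (.case V' M' N')
  | lam_beta {Γ : Ctx Op} {A : VTy Op} {C : CTy Op} (M : Comp (A :: Γ) C) (V : Val Γ A) :
      CompEq (.app (.lam M) V) (M.inst V)
  | ret_let {Γ : Ctx Op} {A B : VTy Op} {S : Sig Op (VTy Op)} (V : Val Γ A)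
      (M : Comp (A :: Γ) ⟨B, S⟩) : CompEq (.letin (.ret V) M) (M.inst V)
  | let_ret {Γ : Ctx Op} {A : VTy Op} {S : Sig Op (VTy Op)} (M : Comp Γ ⟨A, S⟩) :
      CompEq (.letin M (.ret (.var .zero))) M
  | let_let {Γ : Ctx Op} {A₁ A₂ A₃ : VTy Op} {S : Sig Op (VTy Op)} (M : Comp Γ ⟨A₁, S⟩)
      (N : Comp (A₁ :: Γ) ⟨A₂, S⟩) (L : Comp (A₂ :: Γ) ⟨A₃, S⟩) :
      CompEq (.letin (.letin M N) L) (.letin M (.letin N (L.weakenUnder A₁)))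
  | handle_ret {Γ : Ctx Op} {A : VTy Op} {S : Sig Op (VTy Op)} {C : CTy Op} (V : Val Γ A)
      (H : Hdl Γ S C) (M : Comp (A :: Γ) C) : CompEq (.handle (.ret V) H M) (M.inst V)
  | handle_let {Γ : Ctx Op} {A B : VTy Op} {S : Sig Op (VTy Op)} {C : CTy Op}
      (L : Comp Γ ⟨A, S⟩) (M : Comp (A :: Γ) ⟨B, S⟩) (H : Hdl Γ S C) (N : Comp (B :: Γ) C) :
      CompEq (.handle (.letin L M) H N)
        (.handle L H (.handle M (Hdl.weaken H A) (N.weakenUnder A)))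
  | handle_op {Γ : Ctx Op} {S : Sig Op (VTy Op)} {C : CTy Op} (o : {o // o ∈ S.dom})
      (V : Val Γ (S.arg o)) (H : Hdl Γ S C) (M : Comp (S.res o :: Γ) C) :
      CompEq (.handle (.op o V) H M) ((H o).inst₂ V (.lam M))
  | case_inl {Γ : Ctx Op} {A B : VTy Op} {C : CTy Op} (V : Val Γ A)
      (M : Comp (A :: Γ) C) (N : Comp (B :: Γ) C) : CompEq (.case (.inl V) M N) (M.inst V)
  | case_inr {Γ : Ctx Op} {A B : VTy Op} {C : CTy Op} (V : Val Γ B)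
      (M : Comp (A :: Γ) C) (N : Comp (B :: Γ) C) : CompEq (.case (.inr V) M N) (N.inst V)
  | case_eta {Γ : Ctx Op} {A B : VTy Op} {C : CTy Op} (V : Val Γ (.sum A B))
      (M : Comp (.sum A B :: Γ) C) :
      CompEq (.case V (M.replace (.inl (.var .zero))) (M.replace (.inr (.var .zero)))) (M.inst V)

/-- Derivability of `Γ ⊢ H = H' : Σ ⇒ C`. -/
inductive HdlEq : {Γ : Ctx Op} → {S : Sig Op (VTy Op)} → {C : CTy Op} →
    Hdl Γ S C → Hdl Γ S C → Prop
  | refl {Γ : Ctx Op} {S : Sig Op (VTy Op)} {C : CTy Op} (H : Hdl Γ S C) : HdlEq H H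
  | symm {Γ : Ctx Op} {S : Sig Op (VTy Op)} {C : CTy Op} {H H' : Hdl Γ S C} :
      HdlEq H H' → HdlEq H' H
  | trans {Γ : Ctx Op} {S : Sig Op (VTy Op)} {C : CTy Op} {H H' H'' : Hdl Γ S C} :
      HdlEq H H' → HdlEq H' H'' → HdlEq H H''
  | congr {Γ : Ctx Op} {S : Sig Op (VTy Op)} {C : CTy Op} {H H' : Hdl Γ S C} :
      (∀ o, CompEq (H o) (H' o)) → HdlEq H H'

end

end Calculus

/-! ## Models -/

section Models

/-- Strong monads on a cartesian category. -/
structure StrongMonad (C : Type u) [Category.{v} C] [CartesianMonoidalCategory C] extends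
    CategoryTheory.Monad C where
  st : ∀ X Y : C, X ⊗ obj Y ⟶ obj (X ⊗ Y)
  st_natural : ∀ {X X' Y Y' : C} (f : X ⟶ X') (g : Y ⟶ Y'),
    (f ⊗ₘ map g) ≫ st X' Y' = st X Y ≫ map (f ⊗ₘ g)
  st_leftUnitor : ∀ X : C, st (𝟙_ C) X ≫ map (λ_ X).hom = (λ_ (obj X)).hom
  st_associator : ∀ X Y Z : C,
    st (X ⊗ Y) Z ≫ map (α_ X Y Z).hom = (α_ X Y (obj Z)).hom ≫ (X ◁ st Y Z) ≫ st X (Y ⊗ Z)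
  st_unit : ∀ X Y : C, (X ◁ η.app Y) ≫ st X Y = η.app (X ⊗ Y)
  st_mult : ∀ X Y : C,
    (X ◁ μ.app Y) ≫ st X Y = st X (obj Y) ≫ map (st X Y) ≫ μ.app (X ⊗ Y)

/-- A Kleisli exponential `Y ⇒ Z` for `T`: an object representing `X ↦ C_T(J(X ⊗ Y), Z)`; the
hom-set `C_T(J(X ⊗ Y), Z)` of the Kleisli category is `C(X ⊗ Y, T Z)`. -/
structure KleisliExp {C : Type u} [Category.{v} C] [CartesianMonoidalCategory C]
    (T : StrongMonad C) (Y Z : C) where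
  pt : C
  curry : ∀ {X : C}, (X ⊗ Y ⟶ T.obj Z) ≃ (X ⟶ pt)
  curry_natural : ∀ {X X' : C} (f : X' ⟶ X) (g : X ⊗ Y ⟶ T.obj Z),
    curry ((f ▷ Y) ≫ g) = f ≫ curry g

/-- The evaluation morphism of a Kleisli exponential. -/
def KleisliExp.eval {C : Type u} [Category.{v} C] [CartesianMonoidalCategory C]
    {T : StrongMonad C} {Y Z : C} (E : KleisliExp T Y Z) : E.pt ⊗ Y ⟶ T.obj Z :=
  E.curry.symm (𝟙 E.pt)

/-- The diagram `X₁ ⟶ P ⟵ X₂` is a Kleisli binary coproduct for `T`. -/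
def IsKleisliCoprod {C : Type u} [Category.{v} C] [CartesianMonoidalCategory C]
    (T : StrongMonad C) {X₁ X₂ P : C} (i₁ : X₁ ⟶ P) (i₂ : X₂ ⟶ P) : Prop :=
  ∀ (Y : C) (f₁ : X₁ ⟶ T.obj Y) (f₂ : X₂ ⟶ T.obj Y),
    ∃! h : P ⟶ T.obj Y, i₁ ≫ h = f₁ ∧ i₂ ≫ h = f₂

/-- The diagram `X₁ ⟶ P ⟵ X₂` is a distributive Kleisli binary coproduct for `T`. -/
def IsDistribKleisliCoprod {C : Type u} [Category.{v} C] [CartesianMonoidalCategory C]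
    (T : StrongMonad C) {X₁ X₂ P : C} (i₁ : X₁ ⟶ P) (i₂ : X₂ ⟶ P) : Prop :=
  IsKleisliCoprod T i₁ i₂ ∧ ∀ Z : C, IsKleisliCoprod T (Z ◁ i₁) (Z ◁ i₂)

/-- The first layer of a model on the cartesian category `C`: a choice of finite products for
finite tuples and for families indexed by a finite set of operation symbols (the chosen terminal
object and binary products are those of `CartesianMonoidalCategory C`), strong monads `T_S` indexed
by semantic signatures, Kleisli exponentials for each `T_S`, and morphisms `A_op ⟶ T_S B_op`
for `op : A_op ↠ B_op` in `S`. -/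
structure EffFrame (Op : Type w) (C : Type u) [Category.{v} C] [CartesianMonoidalCategory C] where
  tup : ∀ {n : ℕ} (X : Fin n → C), LimitCone (Discrete.functor X)
  opProd : ∀ (d : Finset Op) (X : {o // o ∈ d} → C), LimitCone (Discrete.functor X)
  T : Sig Op C → StrongMonad C
  kexp : ∀ (S : Sig Op C) (Y Z : C), KleisliExp (T S) Y Z
  op : ∀ (S : Sig Op C) (o : {o // o ∈ S.dom}), S.arg o ⟶ (T S).obj (S.res o)

namespace EffFrame

variable {Op : Type w} {C : Type u} [Category.{v} C] [CartesianMonoidalCategory C]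
  (F : EffFrame Op C)

/-- The type of handler clauses for `op ∈ S` with values in `X ∈ C_{T_{S'}}`: the object
`(A_op × (B_op ⇒ X)) ⇒ X`, with Kleisli exponentials for `T_{S'}`. -/
def clauseObj (S S' : Sig Op C) (X : C) (o : {o // o ∈ S.dom}) : C :=
  (F.kexp S' (S.arg o ⊗ (F.kexp S' (S.res o) X).pt) X).pt

/-- The object `∏_{op ∈ S} ((A_op × (B_op ⇒ X)) ⇒ X)` of handlers, for `X ∈ C_{T_{S'}}`. -/
def hdlObj (S S' : Sig Op C) (X : C) : C := (F.opProd S.dom (F.clauseObj S S' X)).cone.pt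

/-- The projection `π_op` from the object of handlers. -/
def hdlProj (S S' : Sig Op C) (X : C) (o : {o // o ∈ S.dom}) :
    F.hdlObj S S' X ⟶ F.clauseObj S S' X o :=
  Fan.proj (F.opProd S.dom (F.clauseObj S S' X)).cone o

/-- The tupling of a family of morphisms into the object of handlers. -/
def hdlLift (S S' : Sig Op C) (X : C) {Z : C} (f : ∀ o, Z ⟶ F.clauseObj S S' X o) :
    Z ⟶ F.hdlObj S S' X :=
  Fan.IsLimit.lift (F.opProd S.dom (F.clauseObj S S' X)).isLimit f

/-- The morphism `A_op × (B_op ⇒ X) ⟶ T_S T_{S'} X` induced by `op : A_op ⟶ T_S B_op`. -/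
def mixedOp (S S' : Sig Op C) (X : C) (o : {o // o ∈ S.dom}) :
    S.arg o ⊗ (F.kexp S' (S.res o) X).pt ⟶ (F.T S).obj ((F.T S').obj X) :=
  (F.op S o ▷ _) ≫ lift (snd _ _) (fst _ _) ≫ (F.T S).st _ _ ≫
    (F.T S).map (F.kexp S' (S.res o) X).eval

end EffFrame

/-- Models of the calculus without sum types. -/
structure EffModel (Op : Type w) (C : Type u) [Category.{v} C] [CartesianMonoidalCategory C]
    extends EffFrame Op C where
  handle : ∀ (S S' : Sig Op C) (X : C),
    toEffFrame.hdlObj S S' X ⊗ (T S).obj ((T S').obj X) ⟶ (T S').obj X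
  handle_unit : ∀ (S S' : Sig Op C) (X : C),
    (toEffFrame.hdlObj S S' X ◁ (T S).η.app ((T S').obj X)) ≫ handle S S' X = snd _ _
  handle_mult : ∀ (S S' : Sig Op C) (X : C),
    (toEffFrame.hdlObj S S' X ◁ (T S).μ.app ((T S').obj X)) ≫ handle S S' X =
      lift (fst _ _) ((T S).st (toEffFrame.hdlObj S S' X) ((T S).obj ((T S').obj X))) ≫
        (toEffFrame.hdlObj S S' X ◁ (T S).map (handle S S' X)) ≫ handle S S' X
  handle_op : ∀ (S S' : Sig Op C) (X : C) (o : {o // o ∈ S.dom}),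
    (toEffFrame.hdlObj S S' X ◁ toEffFrame.mixedOp S S' X o) ≫ handle S S' X =
      (toEffFrame.hdlProj S S' X o ▷ _) ≫ (kexp S' _ X).eval

/-- Models of the calculus with sum types: models with joint distributive Kleisli binary
coproducts for all the monads `T_S`. -/
structure EffPlusModel (Op : Type w) (C : Type u) [Category.{v} C] [CartesianMonoidalCategory C]
    extends EffModel Op C where
  sum : C → C → C
  inl : ∀ X Y : C, X ⟶ sum X Y
  inr : ∀ X Y : C, Y ⟶ sum X Y
  isDistribKleisliCoprod : ∀ (S : Sig Op C) (X Y : C),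
    IsDistribKleisliCoprod (T S) (inl X Y) (inr X Y)

/-! ## Interpretation -/

namespace EffPlusModel

variable {Op : Type w} {C : Type u} [Category.{v} C] [CartesianMonoidalCategory C]
  (𝓜 : EffPlusModel Op C)

/-- The unique `h : Z × (X + Y) ⟶ T_S W` restricting to `f` on `Z × X` and to `g` on `Z × Y`. -/
noncomputable def copair (S : Sig Op C) {Z X Y W : C} (f : Z ⊗ X ⟶ (𝓜.T S).obj W)
    (g : Z ⊗ Y ⟶ (𝓜.T S).obj W) : Z ⊗ 𝓜.sum X Y ⟶ (𝓜.T S).obj W :=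
  ((𝓜.isDistribKleisliCoprod S X Y).2 Z W f g).choose

/-- Interpretation of value types. -/
def ty : VTy Op → C
  | .arrow A d a r B => (𝓜.kexp ⟨d, fun o => ty (a o), fun o => ty (r o)⟩ (ty A) (ty B)).pt
  | .prod A => (𝓜.tup fun i => ty (A i)).cone.pt
  | .sum A B => 𝓜.sum (ty A) (ty B)

/-- Interpretation of signatures. -/
def sig (S : Sig Op (VTy Op)) : Sig Op C := S.map 𝓜.ty

/-- Interpretation of computation types: `A ! Σ` is sent to `T_Σ A`. -/
def cty (D : CTy Op) : C := (𝓜.T (𝓜.sig D.sig)).obj (𝓜.ty D.val)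

/-- Interpretation of contexts. -/
def ctx : Ctx Op → C
  | [] => 𝟙_ C
  | A :: Γ => ctx Γ ⊗ 𝓜.ty A

/-- Interpretation of variables. -/
def var : {Γ : Ctx Op} → {A : VTy Op} → Var Γ A → (𝓜.ctx Γ ⟶ 𝓜.ty A)
  | _, _, .zero => snd _ _
  | _, _, .succ x => fst _ _ ≫ var x

mutual

/-- Interpretation of value terms. -/
noncomputable def val : {Γ : Ctx Op} → {A : VTy Op} → Val Γ A → (𝓜.ctx Γ ⟶ 𝓜.ty A)
  | _, _, .var x => 𝓜.var x
  | _, _, .lam (A := A) (C := D) M =>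
      (𝓜.kexp (𝓜.sig D.sig) (𝓜.ty A) (𝓜.ty D.val)).curry (comp M)
  | _, _, .tuple (A := A) V =>
      Fan.IsLimit.lift (𝓜.tup fun i => 𝓜.ty (A i)).isLimit fun i => val (V i)
  | _, _, .proj (A := A) i V => val V ≫ Fan.proj (𝓜.tup fun i => 𝓜.ty (A i)).cone i
  | _, _, .inl V => val V ≫ 𝓜.inl _ _
  | _, _, .inr V => val V ≫ 𝓜.inr _ _

/-- Interpretation of computation terms. -/
noncomputable def comp : {Γ : Ctx Op} → {D : CTy Op} → Comp Γ D → (𝓜.ctx Γ ⟶ 𝓜.cty D)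
  | _, D, .app (A := A) V W =>
      lift (val V) (val W) ≫ (𝓜.kexp (𝓜.sig D.sig) (𝓜.ty A) (𝓜.ty D.val)).eval
  | _, _, .ret (S := S) V => val V ≫ (𝓜.T (𝓜.sig S)).η.app _
  | _, _, .letin (S := S) M N =>
      lift (𝟙 _) (comp M) ≫ (𝓜.T (𝓜.sig S)).st _ _ ≫ (𝓜.T (𝓜.sig S)).map (comp N) ≫
        (𝓜.T (𝓜.sig S)).μ.app _
  | _, _, .op (S := S) o V => val V ≫ 𝓜.op (𝓜.sig S) o
  | _, D, .handle (S := S) M H N =>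
      lift
        (𝓜.hdlLift (𝓜.sig S) (𝓜.sig D.sig) (𝓜.ty D.val) fun o =>
          (𝓜.kexp (𝓜.sig D.sig) _ (𝓜.ty D.val)).curry ((α_ _ _ _).inv ≫ comp (H o)))
        (lift (𝟙 _) (comp M) ≫ (𝓜.T (𝓜.sig S)).st _ _ ≫ (𝓜.T (𝓜.sig S)).map (comp N)) ≫
      𝓜.handle (𝓜.sig S) (𝓜.sig D.sig) (𝓜.ty D.val)
  | _, D, .case V M N =>
      lift (𝟙 _) (val V) ≫ 𝓜.copair (𝓜.sig D.sig) (comp M) (comp N)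

end

/-- Interpretation of handlers: the tupling of the interpretations of the clauses. -/
noncomputable def hdl {Γ : Ctx Op} {S : Sig Op (VTy Op)} {D : CTy Op} (H : Hdl Γ S D) :
    𝓜.ctx Γ ⟶ 𝓜.hdlObj (𝓜.sig S) (𝓜.sig D.sig) (𝓜.ty D.val) :=
  𝓜.hdlLift (𝓜.sig S) (𝓜.sig D.sig) (𝓜.ty D.val) fun o =>
    (𝓜.kexp (𝓜.sig D.sig) _ (𝓜.ty D.val)).curry ((α_ _ _ _).inv ≫ 𝓜.comp (H o))

end EffPlusModel

end Models

end LambdaEff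

/-!
Soundness rests on the semantic substitution lemma: the interpretation of `M[σ]` is `f` followed by
the interpretation of `M`, where `f` is the morphism of contexts whose components are the
interpretations of the terms of `σ`. It turns each equation of the calculus into a law of strong
monads, of `handle` or of distributive Kleisli coproducts.

For completeness, the value types are the objects of a term model with `T_S A = 1 → A ! S`, in which
a morphism `A ⟶ B` is a family of maps from the classes of values of type `A` in context `Γ`, modulo
derivable equality, to those of type `B`, natural in `Γ`. The variables of a context form a single
value of product type, and the interpretation of a term in this model sends their class to the class
of the term itself. As a type is equal to its own interpretation only propositionally, the last
statement is a heterogeneous equality, proved by induction on terms.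
-/

namespace LambdaEff

section Substitution

variable {Op : Type w} {Γ Δ Θ : Ctx Op} {A B : VTy Op} {C : CTy Op} {S : Sig Op (VTy Op)}

/-! ## Substitution calculus -/

/-- The substitution of variables for variables given by a renaming. -/
def Ren.toSubst (ρ : Ren Γ Δ) : Subst Γ Δ := fun _ x => .var (ρ x)

/-- The weakening substitution, from `Γ` to `Γ, x : B`. -/
def Subst.wk (Γ : Ctx Op) (B : VTy Op) : Subst Γ (B :: Γ) := Ren.toSubst fun _ x => x.succ

/-- Composition of substitutions in diagrammatic order: first `σ`, then `τ`. -/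
def Subst.comp (σ : Subst Γ Δ) (τ : Subst Δ Θ) : Subst Γ Θ := fun _ x => (σ x).subst τ

theorem Ren.toSubst_lift (ρ : Ren Γ Δ) (B : VTy Op) :
    (ρ.lift B).toSubst = ρ.toSubst.lift B := by
  funext A x
  cases x <;> simp [Ren.toSubst, Ren.lift, Subst.lift, Val.weaken, Val.rename]

theorem Subst.lift_id (Γ : Ctx Op) (B : VTy Op) : (Subst.id Γ).lift B = Subst.id (B :: Γ) := by
  funext A x
  cases x <;> simp [Subst.lift, Subst.id, Val.weaken, Val.rename]

mutual

theorem Val.rename_eq_subst {Γ Δ : Ctx Op} {A : VTy Op} (ρ : Ren Γ Δ) :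
    (V : Val Γ A) → V.rename ρ = V.subst ρ.toSubst
  | .var x => by simp [Val.rename, Val.subst, Ren.toSubst]
  | .lam M => by simp [Val.rename, Val.subst, M.rename_eq_subst, Ren.toSubst_lift]
  | .tuple V => by simp [Val.rename, Val.subst, fun i => (V i).rename_eq_subst ρ]
  | .proj (A := _) i V => by simp [Val.rename, Val.subst, V.rename_eq_subst]
  | .inl V => by simp [Val.rename, Val.subst, V.rename_eq_subst]
  | .inr V => by simp [Val.rename, Val.subst, V.rename_eq_subst]

theorem Comp.rename_eq_subst {Γ Δ : Ctx Op} {C : CTy Op} (ρ : Ren Γ Δ) :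
    (M : Comp Γ C) → M.rename ρ = M.subst ρ.toSubst
  | .app V W => by simp [Comp.rename, Comp.subst, V.rename_eq_subst, W.rename_eq_subst]
  | .ret V => by simp [Comp.rename, Comp.subst, V.rename_eq_subst]
  | .letin M N => by
    simp [Comp.rename, Comp.subst, M.rename_eq_subst, N.rename_eq_subst, Ren.toSubst_lift]
  | .op o V => by simp [Comp.rename, Comp.subst, V.rename_eq_subst]
  | .handle M H N => by
    simp [Comp.rename, Comp.subst, M.rename_eq_subst,
      fun o => (H o).rename_eq_subst ((ρ.lift _).lift _), N.rename_eq_subst, Ren.toSubst_lift]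
  | .case V M N => by
    simp [Comp.rename, Comp.subst, V.rename_eq_subst, M.rename_eq_subst, N.rename_eq_subst,
      Ren.toSubst_lift]

end

mutual

theorem Val.subst_id {Γ : Ctx Op} {A : VTy Op} : (V : Val Γ A) → V.subst (Subst.id Γ) = V
  | .var x => by simp [Val.subst, Subst.id]
  | .lam M => by simp [Val.subst, M.subst_id, Subst.lift_id]
  | .tuple V => by simp [Val.subst, fun i => (V i).subst_id]
  | .proj (A := _) i V => by simp [Val.subst, V.subst_id]
  | .inl V => by simp [Val.subst, V.subst_id]
  | .inr V => by simp [Val.subst, V.subst_id]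

theorem Comp.subst_id {Γ : Ctx Op} {C : CTy Op} : (M : Comp Γ C) → M.subst (Subst.id Γ) = M
  | .app V W => by simp [Comp.subst, V.subst_id, W.subst_id]
  | .ret V => by simp [Comp.subst, V.subst_id]
  | .letin M N => by simp [Comp.subst, M.subst_id, N.subst_id, Subst.lift_id]
  | .op o V => by simp [Comp.subst, V.subst_id]
  | .handle M H N => by
    simp [Comp.subst, M.subst_id, fun o => (H o).subst_id, N.subst_id, Subst.lift_id]
  | .case V M N => by simp [Comp.subst, V.subst_id, M.subst_id, N.subst_id, Subst.lift_id]

end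

/-- A class `R` of triples of substitutions on which `Subst.comp σ τ = θ` holds and which is closed
under lifting. On such a class the two substitutions compose on all terms; three instances of
increasing generality lead from renamings to arbitrary substitutions. -/
structure Subst.CompClass (R : ∀ {Γ Δ Θ : Ctx Op}, Subst Γ Δ → Subst Δ Θ → Subst Γ Θ → Prop) :
    Prop where
  comp_eq : ∀ {Γ Δ Θ : Ctx Op} {σ : Subst Γ Δ} {τ : Subst Δ Θ} {θ : Subst Γ Θ},
    R σ τ θ → σ.comp τ = θ
  lift : ∀ {Γ Δ Θ : Ctx Op} {σ : Subst Γ Δ} {τ : Subst Δ Θ} {θ : Subst Γ Θ},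
    R σ τ θ → ∀ B, R (σ.lift B) (τ.lift B) (θ.lift B)

section CompClass

variable {R : ∀ {Γ Δ Θ : Ctx Op}, Subst Γ Δ → Subst Δ Θ → Subst Γ Θ → Prop}

mutual

theorem Val.subst_subst_of_compClass (hR : Subst.CompClass R) {Γ Δ Θ : Ctx Op} {A : VTy Op}
    {σ : Subst Γ Δ} {τ : Subst Δ Θ} {θ : Subst Γ Θ} (h : R σ τ θ) :
    (V : Val Γ A) → (V.subst σ).subst τ = V.subst θ
  | .var x => by simp [Val.subst, ← hR.comp_eq h, Subst.comp]
  | .lam M => by simp [Val.subst, M.subst_subst_of_compClass hR (hR.lift h _)]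
  | .tuple V => by simp [Val.subst, fun i => (V i).subst_subst_of_compClass hR h]
  | .proj (A := _) i V => by simp [Val.subst, V.subst_subst_of_compClass hR h]
  | .inl V => by simp [Val.subst, V.subst_subst_of_compClass hR h]
  | .inr V => by simp [Val.subst, V.subst_subst_of_compClass hR h]

theorem Comp.subst_subst_of_compClass (hR : Subst.CompClass R) {Γ Δ Θ : Ctx Op} {C : CTy Op}
    {σ : Subst Γ Δ} {τ : Subst Δ Θ} {θ : Subst Γ Θ} (h : R σ τ θ) :
    (M : Comp Γ C) → (M.subst σ).subst τ = M.subst θ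
  | .app V W => by
    simp [Comp.subst, V.subst_subst_of_compClass hR h, W.subst_subst_of_compClass hR h]
  | .ret V => by simp [Comp.subst, V.subst_subst_of_compClass hR h]
  | .letin M N => by
    simp [Comp.subst, M.subst_subst_of_compClass hR h,
      N.subst_subst_of_compClass hR (hR.lift h _)]
  | .op o V => by simp [Comp.subst, V.subst_subst_of_compClass hR h]
  | .handle M H N => by
    simp [Comp.subst, M.subst_subst_of_compClass hR h,
      fun o => (H o).subst_subst_of_compClass hR (hR.lift (hR.lift h _) _),
      N.subst_subst_of_compClass hR (hR.lift h _)]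
  | .case V M N => by
    simp [Comp.subst, V.subst_subst_of_compClass hR h,
      M.subst_subst_of_compClass hR (hR.lift h _), N.subst_subst_of_compClass hR (hR.lift h _)]

end

end CompClass

theorem Subst.compClass_toSubst_left :
    Subst.CompClass fun {Γ Δ Θ : Ctx Op} (σ : Subst Γ Δ) (τ : Subst Δ Θ) θ =>
      ∃ ρ : Ren Γ Δ, σ = ρ.toSubst ∧ θ = fun _ x => τ (ρ x) where
  comp_eq := by
    rintro Γ Δ Θ _ τ _ ⟨ρ, rfl, rfl⟩
    funext A x
    simp [Subst.comp, Ren.toSubst, Val.subst]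
  lift := by
    rintro Γ Δ Θ _ τ _ ⟨ρ, rfl, rfl⟩ B
    refine ⟨ρ.lift B, (ρ.toSubst_lift B).symm, ?_⟩
    funext A x
    cases x <;> rfl

theorem Val.rename_subst (ρ : Ren Γ Δ) (σ : Subst Δ Θ) (V : Val Γ A) :
    (V.rename ρ).subst σ = V.subst fun _ x => σ (ρ x) := by
  rw [V.rename_eq_subst,
    V.subst_subst_of_compClass Subst.compClass_toSubst_left ⟨ρ, rfl, rfl⟩]

theorem Subst.compClass_toSubst_right :
    Subst.CompClass fun {Γ Δ Θ : Ctx Op} (σ : Subst Γ Δ) (τ : Subst Δ Θ) θ =>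
      ∃ ρ : Ren Δ Θ, τ = ρ.toSubst ∧ θ = σ.comp τ where
  comp_eq := by
    rintro Γ Δ Θ σ _ _ ⟨ρ, rfl, rfl⟩
    rfl
  lift := by
    rintro Γ Δ Θ σ _ _ ⟨ρ, rfl, rfl⟩ B
    refine ⟨ρ.lift B, (ρ.toSubst_lift B).symm, ?_⟩
    funext A x
    cases x with
    | zero => simp [Subst.lift, Subst.comp, Val.subst]
    | succ x =>
      simp only [Subst.lift, Subst.comp, Val.weaken]
      rw [Val.rename_subst, ← Val.rename_eq_subst ρ, Val.rename_eq_subst _ (Val.rename _ _),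
        Val.rename_subst]
      rfl

theorem Subst.compClass_comp :
    Subst.CompClass fun {Γ Δ Θ : Ctx Op} (σ : Subst Γ Δ) (τ : Subst Δ Θ) θ => θ = σ.comp τ where
  comp_eq h := h.symm
  lift := by
    rintro Γ Δ Θ σ τ _ rfl B
    funext A x
    cases x with
    | zero => simp [Subst.lift, Subst.comp, Val.subst]
    | succ x =>
      simp only [Subst.lift, Subst.comp, Val.weaken]
      rw [Val.rename_subst, Val.rename_eq_subst,
        (σ x).subst_subst_of_compClass Subst.compClass_toSubst_right ⟨_, rfl, rfl⟩]
      congr 1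
      funext _ y
      exact ((τ y).rename_eq_subst _).symm

theorem Val.subst_subst (σ : Subst Γ Δ) (τ : Subst Δ Θ) (V : Val Γ A) :
    (V.subst σ).subst τ = V.subst (σ.comp τ) :=
  V.subst_subst_of_compClass Subst.compClass_comp rfl

theorem Comp.subst_subst (σ : Subst Γ Δ) (τ : Subst Δ Θ) (M : Comp Γ C) :
    (M.subst σ).subst τ = M.subst (σ.comp τ) :=
  M.subst_subst_of_compClass Subst.compClass_comp rfl

namespace Subst

theorem lift_comp_lift (σ : Subst Γ Δ) (τ : Subst Δ Θ) (B : VTy Op) :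
    (σ.lift B).comp (τ.lift B) = (σ.comp τ).lift B :=
  (compClass_comp.lift rfl B).symm ▸ rfl

theorem wk_comp (τ : Subst (B :: Γ) Δ) : (wk Γ B).comp τ = fun _ x => τ x.succ := by
  funext A x
  simp only [comp, wk, Ren.toSubst, Val.subst]

theorem wk_comp_lift (σ : Subst Γ Δ) (B : VTy Op) :
    (wk Γ B).comp (σ.lift B) = σ.comp (wk Δ B) := by
  rw [wk_comp]
  funext A x
  exact (σ x).rename_eq_subst _

theorem comp_id (σ : Subst Γ Δ) : σ.comp (Subst.id Δ) = σ := by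
  funext A x
  exact (σ x).subst_id

theorem id_comp (σ : Subst Γ Δ) : (Subst.id Γ).comp σ = σ := by
  funext A x
  simp only [comp, Subst.id, Val.subst]

theorem cons_comp (σ : Subst Γ Δ) (V : Val Δ B) (τ : Subst Δ Θ) :
    (σ.cons V).comp τ = (σ.comp τ).cons (V.subst τ) := by
  funext A x
  cases x <;> rfl

theorem lift_comp_cons (σ : Subst Γ Δ) (τ : Subst Δ Θ) (V : Val Θ B) :
    (σ.lift B).comp (τ.cons V) = (σ.comp τ).cons V := by
  funext A x
  cases x with
  | zero => simp only [comp, lift, Val.subst, cons]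
  | succ x => exact Val.rename_subst _ _ _

end Subst

theorem Val.weaken_eq_subst (V : Val Γ A) (B : VTy Op) : V.weaken B = V.subst (Subst.wk Γ B) :=
  V.rename_eq_subst _

theorem Hdl.weaken_eq_subst (H : Hdl Γ S C) (B : VTy Op) (o : {o // o ∈ S.dom}) :
    H.weaken B o = (H o).subst (((Subst.wk Γ B).lift _).lift _) := by
  rw [Hdl.weaken, Comp.rename_eq_subst, Ren.toSubst_lift, Ren.toSubst_lift, Subst.wk]

theorem Comp.weakenUnder_eq_subst (M : Comp (A :: Γ) C) (B : VTy Op) :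
    M.weakenUnder B = M.subst ((Subst.wk Γ B).lift A) := by
  rw [Comp.weakenUnder, Comp.rename_eq_subst, Ren.toSubst_lift, Subst.wk]

theorem Comp.replace_eq_subst (M : Comp (A :: Γ) C) (V : Val (B :: Γ) A) :
    M.replace V = M.subst ((Subst.wk Γ B).cons V) :=
  rfl

theorem Val.weaken_subst (V : Val Γ A) (B : VTy Op) (σ : Subst Γ Δ) :
    (V.weaken B).subst (σ.lift B) = (V.subst σ).weaken B := by
  simp only [Val.weaken_eq_subst, Val.subst_subst, Subst.wk_comp_lift]

theorem Hdl.weaken_subst (H : Hdl Γ S C) (B : VTy Op) (σ : Subst Γ Δ) :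
    (fun o => (H.weaken B o).subst (((σ.lift B).lift _).lift _)) =
      Hdl.weaken (S := S) (fun o => (H o).subst ((σ.lift _).lift _)) B := by
  funext o
  simp only [Hdl.weaken_eq_subst, Comp.subst_subst, Subst.lift_comp_lift, Subst.wk_comp_lift]

theorem Comp.weakenUnder_subst (M : Comp (A :: Γ) C) (B : VTy Op) (σ : Subst Γ Δ) :
    (M.weakenUnder B).subst ((σ.lift B).lift A) = (M.subst (σ.lift A)).weakenUnder B := by
  simp only [Comp.weakenUnder_eq_subst, Comp.subst_subst, Subst.lift_comp_lift,
    Subst.wk_comp_lift]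

theorem Comp.inst_subst (M : Comp (A :: Γ) C) (V : Val Γ A) (σ : Subst Γ Δ) :
    (M.inst V).subst σ = (M.subst (σ.lift A)).inst (V.subst σ) := by
  simp only [Comp.inst, Comp.subst_subst, Subst.cons_comp, Subst.lift_comp_cons, Subst.id_comp,
    Subst.comp_id]

theorem Comp.inst₂_subst (M : Comp (B :: A :: Γ) C) (V : Val Γ A) (W : Val Γ B) (σ : Subst Γ Δ) :
    (M.inst₂ V W).subst σ = (M.subst ((σ.lift A).lift B)).inst₂ (V.subst σ) (W.subst σ) := by
  simp only [Comp.inst₂, Comp.subst_subst, Subst.cons_comp, Subst.lift_comp_cons, Subst.id_comp,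
    Subst.comp_id]

theorem Comp.replace_subst (M : Comp (A :: Γ) C) (V : Val (B :: Γ) A) (σ : Subst Γ Δ) :
    (M.replace V).subst (σ.lift B) = (M.subst (σ.lift A)).replace (V.subst (σ.lift B)) := by
  simp only [Comp.replace_eq_subst, Comp.subst_subst, Subst.cons_comp, Subst.lift_comp_cons,
    Subst.wk_comp_lift]

mutual

theorem ValEq.subst {Γ Δ : Ctx Op} {A : VTy Op} {V W : Val Γ A} (σ : Subst Γ Δ) :
    ValEq V W → ValEq (V.subst σ) (W.subst σ)
  | .refl V => .refl _
  | .symm h => .symm (h.subst σ)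
  | .trans h h' => .trans (h.subst σ) (h'.subst σ)
  | .lam_congr h => by simpa only [Val.subst] using .lam_congr (h.subst _)
  | .tuple_congr h => by simpa only [Val.subst] using .tuple_congr fun i => (h i).subst σ
  | .proj_congr (A := _) i h => by simpa only [Val.subst] using .proj_congr i (h.subst σ)
  | .inl_congr h => by simpa only [Val.subst] using .inl_congr (h.subst σ)
  | .inr_congr h => by simpa only [Val.subst] using .inr_congr (h.subst σ)
  | .lam_eta V => by
    have := ValEq.lam_eta (V.subst σ)
    simpa only [Val.subst, Comp.subst, Val.weaken_subst, Subst.lift] using this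
  | .prod_beta (A := _) V i => by simpa only [Val.subst] using .prod_beta (fun i => (V i).subst σ) i
  | .prod_eta V => by simpa only [Val.subst] using .prod_eta (V.subst σ)

theorem CompEq.subst {Γ Δ : Ctx Op} {C : CTy Op} {M N : Comp Γ C} (σ : Subst Γ Δ) :
    CompEq M N → CompEq (M.subst σ) (N.subst σ)
  | .refl M => .refl _
  | .symm h => .symm (h.subst σ)
  | .trans h h' => .trans (h.subst σ) (h'.subst σ)
  | .app_congr h h' => by simpa only [Comp.subst] using .app_congr (h.subst σ) (h'.subst σ)
  | .ret_congr h => by simpa only [Comp.subst] using .ret_congr (h.subst σ)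
  | .letin_congr h h' => by simpa only [Comp.subst] using .letin_congr (h.subst σ) (h'.subst _)
  | .op_congr o h => by simpa only [Comp.subst] using .op_congr o (h.subst σ)
  | .handle_congr h h' h'' => by
    simpa only [Comp.subst] using .handle_congr (h.subst σ) (h'.subst σ) (h''.subst _)
  | .case_congr h h' h'' => by
    simpa only [Comp.subst] using .case_congr (h.subst σ) (h'.subst _) (h''.subst _)
  | .lam_beta M V => by
    simpa only [Val.subst, Comp.subst, Comp.inst_subst] using .lam_beta (M.subst (σ.lift _)) _
  | .ret_let V M => by
    simpa only [Val.subst, Comp.subst, Comp.inst_subst] using .ret_let _ (M.subst (σ.lift _))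
  | .let_ret M => by simpa only [Val.subst, Comp.subst] using .let_ret (M.subst σ)
  | .let_let M N L => by
    simpa only [Comp.subst, Comp.weakenUnder_subst] using .let_let _ _ _
  | .handle_ret V H M => by
    simpa only [Comp.subst, Comp.inst_subst] using .handle_ret _ _ _
  | .handle_let L M H N => by
    have := CompEq.handle_let (L.subst σ) (M.subst (σ.lift _))
      (fun o => (H o).subst ((σ.lift _).lift _)) (N.subst (σ.lift _))
    rw [← Hdl.weaken_subst] at this
    simpa only [Comp.subst, Comp.weakenUnder_subst] using this
  | .handle_op o V H M => by
    simpa only [Val.subst, Comp.subst, Comp.inst₂_subst] using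
      .handle_op o (V.subst σ) (fun o => (H o).subst ((σ.lift _).lift _)) (M.subst (σ.lift _))
  | .case_inl V M N => by
    simpa only [Val.subst, Comp.subst, Comp.inst_subst] using .case_inl _ _ _
  | .case_inr V M N => by
    simpa only [Val.subst, Comp.subst, Comp.inst_subst] using .case_inr _ _ _
  | .case_eta V M => by
    simpa only [Val.subst, Comp.subst, Comp.inst_subst, Comp.replace_subst] using
      .case_eta (V.subst σ) (M.subst (σ.lift _))

theorem HdlEq.subst {Γ Δ : Ctx Op} {S : Sig Op (VTy Op)} {C : CTy Op} {H H' : Hdl Γ S C}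
    (σ : Subst Γ Δ) : HdlEq H H' →
      HdlEq (fun o => (H o).subst ((σ.lift _).lift _)) (fun o => (H' o).subst ((σ.lift _).lift _))
  | .refl H => .refl _
  | .symm h => .symm (h.subst σ)
  | .trans h h' => .trans (h.subst σ) (h'.subst σ)
  | .congr h => .congr fun o => (h o).subst _

end

end Substitution

section

variable {Op : Type w} {C : Type u} [Category.{v} C] [CartesianMonoidalCategory C]

/-! ## Calculus of strong monads -/

namespace StrongMonad

variable (T : StrongMonad C)

/-- The action of `T` on `n` with an additional parameter in `X`, applied to the computation `m`. -/
def mapWith {X A W : C} (m : X ⟶ T.obj A) (n : X ⊗ A ⟶ W) : X ⟶ T.obj W :=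
  lift (𝟙 X) m ≫ T.st X A ≫ T.map n

/-- Sequencing of computations with a parameter: the interpretation of `let a = m in n`. -/
def bindWith {X A B : C} (m : X ⟶ T.obj A) (n : X ⊗ A ⟶ T.obj B) : X ⟶ T.obj B :=
  lift (𝟙 X) m ≫ T.st X A ≫ T.map n ≫ T.μ.app B

theorem bindWith_eq_mapWith_mult {X A B : C} (m : X ⟶ T.obj A) (n : X ⊗ A ⟶ T.obj B) :
    T.bindWith m n = T.mapWith m n ≫ T.μ.app B := by
  simp [bindWith, mapWith]

theorem whiskerRight_st {X X' : C} (f : X ⟶ X') (A : C) :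
    f ▷ T.obj A ≫ T.st X' A = T.st X A ≫ T.map (f ▷ A) := by
  simpa using T.st_natural f (𝟙 A)

theorem whiskerLeft_st (X : C) {A A' : C} (g : A ⟶ A') :
    X ◁ T.map g ≫ T.st X A' = T.st X A ≫ T.map (X ◁ g) := by
  simpa using T.st_natural (𝟙 X) g

theorem comp_mapWith {X Y A W : C} (f : Y ⟶ X) (m : X ⟶ T.obj A) (n : X ⊗ A ⟶ W) :
    f ≫ T.mapWith m n = T.mapWith (f ≫ m) (f ▷ A ≫ n) := by
  have : f ≫ lift (𝟙 X) m = lift (𝟙 Y) (f ≫ m) ≫ f ▷ T.obj A := by simp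
  rw [mapWith, mapWith, ← Category.assoc, this, Category.assoc, ← Category.assoc (f ▷ _),
    whiskerRight_st, Functor.map_comp, Category.assoc]

theorem comp_bindWith {X Y A B : C} (f : Y ⟶ X) (m : X ⟶ T.obj A) (n : X ⊗ A ⟶ T.obj B) :
    f ≫ T.bindWith m n = T.bindWith (f ≫ m) (f ▷ A ≫ n) := by
  rw [bindWith_eq_mapWith_mult, bindWith_eq_mapWith_mult, ← Category.assoc, comp_mapWith]

theorem mapWith_map {X A W W' : C} (m : X ⟶ T.obj A) (n : X ⊗ A ⟶ W) (g : W ⟶ W') :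
    T.mapWith m n ≫ T.map g = T.mapWith m (n ≫ g) := by
  simp [mapWith]

theorem mapWith_unit {X A W : C} (v : X ⟶ A) (n : X ⊗ A ⟶ W) :
    T.mapWith (v ≫ T.η.app A) n = lift (𝟙 X) v ≫ n ≫ T.η.app W := by
  have h : lift (𝟙 X) (v ≫ T.η.app A) = lift (𝟙 X) v ≫ X ◁ T.η.app A := by simp
  have h' : T.η.app (X ⊗ A) ≫ T.map n = n ≫ T.η.app W := (T.η.naturality n).symm
  rw [mapWith, h, Category.assoc, ← Category.assoc (X ◁ _), st_unit, h']

theorem st_snd (X A : C) : T.st X A ≫ T.map (snd X A) = snd X (T.obj A) := by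
  have h : snd X A = toUnit X ▷ A ≫ (λ_ A).hom := snd_def X A
  rw [h, Functor.map_comp, ← Category.assoc, ← whiskerRight_st, Category.assoc, st_leftUnitor]
  exact (snd_def X (T.obj A)).symm

theorem mapWith_snd {X A : C} (m : X ⟶ T.obj A) : T.mapWith m (snd X A) = m := by
  rw [mapWith, st_snd, lift_snd]

theorem lift_mapWith_st {X Y A W : C} (h : X ⟶ Y) (m : X ⟶ T.obj A) (n : X ⊗ A ⟶ W) :
    lift h (T.mapWith m n) ≫ T.st Y W = T.mapWith m (lift (fst X A ≫ h) n) := by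
  have h₁ : lift h (T.mapWith m n) =
      lift h (lift (𝟙 X) m) ≫ Y ◁ T.st X A ≫ Y ◁ T.map n := by simp [mapWith]
  have h₂ : lift h (lift (𝟙 X) m) =
      lift (𝟙 X) m ≫ lift h (𝟙 X) ▷ T.obj A ≫ (α_ Y X (T.obj A)).hom := by
    ext <;> simp
  have h₃ : lift h (𝟙 X) ▷ A ≫ (α_ Y X A).hom ≫ Y ◁ n = lift (fst X A ≫ h) n := by
    have h₄ : lift h (𝟙 X) ▷ A ≫ (α_ Y X A).hom = lift (fst X A ≫ h) (𝟙 _) := by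
      ext <;> simp
    rw [← Category.assoc, h₄, lift_whiskerLeft, Category.id_comp]
  rw [h₁, h₂, mapWith]
  simp only [Category.assoc]
  rw [whiskerLeft_st, ← Category.assoc (Y ◁ _), ← Category.assoc (α_ _ _ _).hom,
    ← st_associator, ← h₃]
  simp only [Functor.map_comp, Category.assoc]
  rw [← Category.assoc (_ ▷ _), whiskerRight_st]
  simp only [Category.assoc]

theorem mapWith_bindWith {X A B W : C} (m : X ⟶ T.obj A) (n : X ⊗ A ⟶ T.obj B)
    (l : X ⊗ B ⟶ W) :
    T.mapWith (T.bindWith m n) l =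
      T.bindWith m (T.mapWith n (fst X A ▷ B ≫ l)) := by
  have h : lift (𝟙 X) (T.bindWith m n) = lift (𝟙 X) (T.mapWith m n) ≫ X ◁ T.μ.app B := by
    simp [bindWith_eq_mapWith_mult]
  have h' : T.mapWith n (fst X A ▷ B ≫ l) = lift (fst X A) n ≫ T.st X B ≫ T.map l := by
    rw [mapWith, Functor.map_comp, ← Category.assoc (T.st _ _), ← whiskerRight_st]
    simp
  have hμ : T.μ.app (X ⊗ B) ≫ T.map l = T.map (T.map l) ≫ T.μ.app W := (T.μ.naturality l).symm
  rw [mapWith, h, Category.assoc, ← Category.assoc (X ◁ _), st_mult]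
  simp only [Category.assoc]
  rw [hμ, ← Category.assoc, lift_mapWith_st, Category.comp_id, ← Category.assoc, mapWith_map,
    ← Category.assoc, mapWith_map, bindWith_eq_mapWith_mult, h', Category.assoc]

theorem bindWith_bindWith {X A B D : C} (m : X ⟶ T.obj A) (n : X ⊗ A ⟶ T.obj B)
    (l : X ⊗ B ⟶ T.obj D) :
    T.bindWith (T.bindWith m n) l = T.bindWith m (T.bindWith n (fst X A ▷ B ≫ l)) := by
  have h : T.μ.app (T.obj D) ≫ T.μ.app D = T.map (T.μ.app D) ≫ T.μ.app D := (T.assoc D).symm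
  rw [bindWith_eq_mapWith_mult T (T.bindWith m n), mapWith_bindWith, bindWith_eq_mapWith_mult,
    bindWith_eq_mapWith_mult, bindWith_eq_mapWith_mult, Category.assoc, h, ← Category.assoc,
    mapWith_map]

theorem bindWith_unit {X A B : C} (v : X ⟶ A) (n : X ⊗ A ⟶ T.obj B) :
    T.bindWith (v ≫ T.η.app A) n = lift (𝟙 X) v ≫ n := by
  have h : T.η.app (T.obj B) ≫ T.μ.app B = 𝟙 (T.obj B) := T.left_unit B
  rw [bindWith_eq_mapWith_mult, mapWith_unit]
  simp only [Category.assoc, h, Category.comp_id]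

theorem bindWith_snd_unit {X A : C} (m : X ⟶ T.obj A) :
    T.bindWith m (snd X A ≫ T.η.app A) = m := by
  have h : T.map (T.η.app A) ≫ T.μ.app A = 𝟙 (T.obj A) := T.right_unit A
  rw [bindWith_eq_mapWith_mult, ← mapWith_map, mapWith_snd, Category.assoc, h, Category.comp_id]

end StrongMonad

namespace KleisliExp

variable {T : StrongMonad C} {Y Z : C} (E : KleisliExp T Y Z)

theorem curry_whiskerRight_eval {X : C} (g : X ⊗ Y ⟶ T.obj Z) : E.curry g ▷ Y ≫ E.eval = g :=
  E.curry.injective (by rw [curry_natural, eval, Equiv.apply_symm_apply, Category.comp_id])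

theorem lift_curry_eval {X : C} (g : X ⊗ Y ⟶ T.obj Z) (w : X ⟶ Y) :
    lift (E.curry g) w ≫ E.eval = lift (𝟙 X) w ≫ g := by
  have h : lift (E.curry g) w = lift (𝟙 X) w ≫ E.curry g ▷ Y := by simp
  rw [h, Category.assoc, curry_whiskerRight_eval]

theorem curry_eval {X : C} (f : X ⟶ E.pt) : E.curry (f ▷ Y ≫ E.eval) = f := by
  rw [curry_natural, eval, Equiv.apply_symm_apply, Category.comp_id]

end KleisliExp

/-! ## Semantic operations of a model -/

theorem EffFrame.hdlLift_hdlProj (F : EffFrame Op C) (S S' : Sig Op C) (X : C) {Z : C}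
    (f : ∀ o, Z ⟶ F.clauseObj S S' X o) (o : {o // o ∈ S.dom}) :
    F.hdlLift S S' X f ≫ F.hdlProj S S' X o = f o :=
  Fan.IsLimit.fac _ _ _

theorem EffFrame.hdlLift_injective (F : EffFrame Op C) (S S' : Sig Op C) (X Z : C) :
    Function.Injective (F.hdlLift S S' X (Z := Z)) := fun f g h =>
  funext fun o => by rw [← F.hdlLift_hdlProj S S' X f, h, F.hdlLift_hdlProj]

theorem EffFrame.comp_hdlLift (F : EffFrame Op C) (S S' : Sig Op C) (X : C) {Y Z : C} (k : Y ⟶ Z)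
    (f : ∀ o, Z ⟶ F.clauseObj S S' X o) :
    k ≫ F.hdlLift S S' X f = F.hdlLift S S' X fun o => k ≫ f o :=
  Fan.IsLimit.hom_ext (F.opProd S.dom (F.clauseObj S S' X)).isLimit _ _ fun o => by
    change (k ≫ F.hdlLift S S' X f) ≫ F.hdlProj S S' X o = F.hdlLift S S' X _ ≫ F.hdlProj S S' X o
    rw [Category.assoc, F.hdlLift_hdlProj, F.hdlLift_hdlProj]

/-- The tuple of the curried clauses `k`: the interpretation of a handler. -/
def EffFrame.hdlOf (F : EffFrame Op C) (S S' : Sig Op C) (X : C) {Z : C}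
    (k : ∀ o : {o // o ∈ S.dom}, (Z ⊗ S.arg o) ⊗ (F.kexp S' (S.res o) X).pt ⟶ (F.T S').obj X) :
    Z ⟶ F.hdlObj S S' X :=
  F.hdlLift S S' X fun o => (F.kexp S' _ X).curry ((α_ _ _ _).inv ≫ k o)

theorem EffFrame.comp_hdlOf (F : EffFrame Op C) (S S' : Sig Op C) (X : C) {Y Z : C} (f : Y ⟶ Z)
    (k : ∀ o : {o // o ∈ S.dom}, (Z ⊗ S.arg o) ⊗ (F.kexp S' (S.res o) X).pt ⟶ (F.T S').obj X) :
    f ≫ F.hdlOf S S' X k = F.hdlOf S S' X fun o => (f ▷ _) ▷ _ ≫ k o := by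
  refine (F.comp_hdlLift S S' X f _).trans (congrArg (F.hdlLift S S' X) (funext fun o => ?_))
  refine (KleisliExp.curry_natural _ f _).symm.trans (congrArg _ ?_)
  simp

theorem EffFrame.hdlOf_hdlProj (F : EffFrame Op C) (S S' : Sig Op C) (X : C) {Z : C}
    (k : ∀ o : {o // o ∈ S.dom}, (Z ⊗ S.arg o) ⊗ (F.kexp S' (S.res o) X).pt ⟶ (F.T S').obj X)
    (o : {o // o ∈ S.dom}) : F.hdlOf S S' X k ≫ F.hdlProj S S' X o =
      (F.kexp S' _ X).curry ((α_ _ _ _).inv ≫ k o) :=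
  F.hdlLift_hdlProj S S' X _ o

namespace EffModel

variable (𝓜 : EffModel Op C) (S S' : Sig Op C)

/-- Handling of a computation with a parameter: the interpretation of `handle m with h to a.n`. -/
def handleWith {X A B : C} (h : X ⟶ 𝓜.hdlObj S S' B) (m : X ⟶ (𝓜.T S).obj A)
    (n : X ⊗ A ⟶ (𝓜.T S').obj B) : X ⟶ (𝓜.T S').obj B :=
  lift h ((𝓜.T S).mapWith m n) ≫ 𝓜.handle S S' B

theorem comp_handleWith {X Y A B : C} (f : Y ⟶ X) (h : X ⟶ 𝓜.hdlObj S S' B)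
    (m : X ⟶ (𝓜.T S).obj A) (n : X ⊗ A ⟶ (𝓜.T S').obj B) :
    f ≫ 𝓜.handleWith S S' h m n = 𝓜.handleWith S S' (f ≫ h) (f ≫ m) (f ▷ A ≫ n) := by
  rw [handleWith, handleWith, ← Category.assoc, comp_lift, StrongMonad.comp_mapWith]

theorem handleWith_unit {X A B : C} (h : X ⟶ 𝓜.hdlObj S S' B) (v : X ⟶ A)
    (n : X ⊗ A ⟶ (𝓜.T S').obj B) :
    𝓜.handleWith S S' h (v ≫ (𝓜.T S).η.app A) n = lift (𝟙 X) v ≫ n := by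
  have : lift h (lift (𝟙 X) v ≫ n ≫ (𝓜.T S).η.app ((𝓜.T S').obj B)) =
      lift h (lift (𝟙 X) v ≫ n) ≫ 𝓜.hdlObj S S' B ◁ (𝓜.T S).η.app ((𝓜.T S').obj B) := by simp
  rw [handleWith, StrongMonad.mapWith_unit, this, Category.assoc, 𝓜.handle_unit]
  exact lift_snd _ _

theorem handleWith_bindWith {X A B D : C} (h : X ⟶ 𝓜.hdlObj S S' D) (m : X ⟶ (𝓜.T S).obj A)
    (n : X ⊗ A ⟶ (𝓜.T S).obj B) (l : X ⊗ B ⟶ (𝓜.T S').obj D) :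
    𝓜.handleWith S S' h ((𝓜.T S).bindWith m n) l =
      𝓜.handleWith S S' h m
        (𝓜.handleWith S S' (fst X A ≫ h) n (fst X A ▷ B ≫ l)) := by
  have h₁ (k : X ⟶ (𝓜.T S).obj ((𝓜.T S).obj ((𝓜.T S').obj D))) :
      lift h (k ≫ (𝓜.T S).μ.app ((𝓜.T S').obj D)) =
      lift h k ≫ 𝓜.hdlObj S S' D ◁ (𝓜.T S).μ.app ((𝓜.T S').obj D) := by simp
  rw [handleWith, StrongMonad.mapWith_bindWith, StrongMonad.bindWith_eq_mapWith_mult, h₁,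
    Category.assoc, 𝓜.handle_mult, ← Category.assoc, comp_lift, lift_fst,
    StrongMonad.lift_mapWith_st, ← Category.assoc, lift_whiskerLeft, StrongMonad.mapWith_map]
  rfl

theorem lift_mixedOp {X B : C} (o : {o // o ∈ S.dom}) (v : X ⟶ S.arg o)
    (n : X ⊗ S.res o ⟶ (𝓜.T S').obj B) :
    lift v ((𝓜.kexp S' (S.res o) B).curry n) ≫ 𝓜.mixedOp S S' B o =
      (𝓜.T S).mapWith (v ≫ 𝓜.op S o) n := by
  have h : lift ((𝓜.kexp S' (S.res o) B).curry n) (v ≫ 𝓜.op S o) =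
      lift (𝟙 X) (v ≫ 𝓜.op S o) ≫ (𝓜.kexp S' (S.res o) B).curry n ▷ _ := by simp
  rw [EffFrame.mixedOp, ← Category.assoc, lift_whiskerRight, ← Category.assoc, comp_lift, lift_snd,
    lift_fst, h, Category.assoc, ← Category.assoc (_ ▷ _), StrongMonad.whiskerRight_st,
    Category.assoc, ← Functor.map_comp, KleisliExp.curry_whiskerRight_eval]
  rfl

theorem handleWith_op {X B : C} (o : {o // o ∈ S.dom})
    (k : ∀ o : {o // o ∈ S.dom}, (X ⊗ S.arg o) ⊗ (𝓜.kexp S' (S.res o) B).pt ⟶ (𝓜.T S').obj B)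
    (v : X ⟶ S.arg o) (n : X ⊗ S.res o ⟶ (𝓜.T S').obj B) :
    𝓜.handleWith S S' (𝓜.hdlOf S S' B k) (v ≫ 𝓜.op S o) n =
      lift (lift (𝟙 X) v) ((𝓜.kexp S' (S.res o) B).curry n) ≫ k o := by
  have h₁ (h : X ⟶ 𝓜.hdlObj S S' B) (a) : lift h (a ≫ 𝓜.mixedOp S S' B o) =
      lift h a ≫ 𝓜.hdlObj S S' B ◁ 𝓜.mixedOp S S' B o := by simp
  have h₂ (a : X ⟶ S.arg o ⊗ (𝓜.kexp S' (S.res o) B).pt) :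
      lift (𝓜.hdlOf S S' B k) a ≫ 𝓜.hdlProj S S' B o ▷ _ =
      lift ((𝓜.kexp S' _ B).curry ((α_ _ _ _).inv ≫ k o)) a := by
    rw [lift_whiskerRight, EffFrame.hdlOf_hdlProj]
    rfl
  have h₃ : lift (𝟙 X) (lift v ((𝓜.kexp S' (S.res o) B).curry n)) ≫ (α_ _ _ _).inv =
      lift (lift (𝟙 X) v) ((𝓜.kexp S' (S.res o) B).curry n) := by
    ext <;> simp
  rw [handleWith, ← lift_mixedOp, h₁, Category.assoc, 𝓜.handle_op]
  refine (Category.assoc _ _ _).symm.trans ((congrArg (· ≫ _) (h₂ _)).trans ?_)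
  refine (KleisliExp.lift_curry_eval _ _ _).trans ?_
  rw [← Category.assoc, h₃]

end EffModel

namespace EffPlusModel

variable (𝓜 : EffPlusModel Op C)

section

variable (S : Sig Op C) {X Y Z W : C}

theorem inl_copair (f : Z ⊗ X ⟶ (𝓜.T S).obj W) (g : Z ⊗ Y ⟶ (𝓜.T S).obj W) :
    Z ◁ 𝓜.inl X Y ≫ 𝓜.copair S f g = f :=
  ((𝓜.isDistribKleisliCoprod S X Y).2 Z W f g).choose_spec.1.1

theorem inr_copair (f : Z ⊗ X ⟶ (𝓜.T S).obj W) (g : Z ⊗ Y ⟶ (𝓜.T S).obj W) :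
    Z ◁ 𝓜.inr X Y ≫ 𝓜.copair S f g = g :=
  ((𝓜.isDistribKleisliCoprod S X Y).2 Z W f g).choose_spec.1.2

theorem copair_comp (h : Z ⊗ 𝓜.sum X Y ⟶ (𝓜.T S).obj W) :
    𝓜.copair S (Z ◁ 𝓜.inl X Y ≫ h) (Z ◁ 𝓜.inr X Y ≫ h) = h :=
  (((𝓜.isDistribKleisliCoprod S X Y).2 Z W _ _).choose_spec.2 h ⟨rfl, rfl⟩).symm

theorem whiskerRight_copair {Z' : C} (k : Z' ⟶ Z) (f : Z ⊗ X ⟶ (𝓜.T S).obj W)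
    (g : Z ⊗ Y ⟶ (𝓜.T S).obj W) :
    k ▷ 𝓜.sum X Y ≫ 𝓜.copair S f g = 𝓜.copair S (k ▷ X ≫ f) (k ▷ Y ≫ g) := by
  rw [← 𝓜.copair_comp S (k ▷ 𝓜.sum X Y ≫ 𝓜.copair S f g), whisker_exchange_assoc,
    whisker_exchange_assoc, inl_copair, inr_copair]

theorem comp_lift_copair {Z' : C} (f : Z' ⟶ Z) (v : Z ⟶ 𝓜.sum X Y) (m : Z ⊗ X ⟶ (𝓜.T S).obj W)
    (n : Z ⊗ Y ⟶ (𝓜.T S).obj W) :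
    f ≫ lift (𝟙 Z) v ≫ 𝓜.copair S m n =
      lift (𝟙 Z') (f ≫ v) ≫ 𝓜.copair S (f ▷ X ≫ m) (f ▷ Y ≫ n) := by
  rw [← whiskerRight_copair, ← Category.assoc (lift _ _), lift_whiskerRight, ← Category.assoc f,
    comp_lift, Category.id_comp, Category.comp_id]

theorem lift_inl_copair (v : Z ⟶ X) (m : Z ⊗ X ⟶ (𝓜.T S).obj W) (n : Z ⊗ Y ⟶ (𝓜.T S).obj W) :
    lift (𝟙 Z) (v ≫ 𝓜.inl X Y) ≫ 𝓜.copair S m n = lift (𝟙 Z) v ≫ m := by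
  rw [← lift_whiskerLeft, Category.assoc, inl_copair]

theorem lift_inr_copair (v : Z ⟶ Y) (m : Z ⊗ X ⟶ (𝓜.T S).obj W) (n : Z ⊗ Y ⟶ (𝓜.T S).obj W) :
    lift (𝟙 Z) (v ≫ 𝓜.inr X Y) ≫ 𝓜.copair S m n = lift (𝟙 Z) v ≫ n := by
  rw [← lift_whiskerLeft, Category.assoc, inr_copair]

end

/-! ## Interpretation of compound terms -/

variable {Γ Δ : Ctx Op}

theorem val_var {A : VTy Op} (x : Var Γ A) : 𝓜.val (.var x) = 𝓜.var x := by
  simp only [val]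

theorem val_lam {A : VTy Op} {D : CTy Op} (M : Comp (A :: Γ) D) :
    𝓜.val (.lam M) = (𝓜.kexp (𝓜.sig D.sig) (𝓜.ty A) (𝓜.ty D.val)).curry (𝓜.comp M) := by
  simp only [val]; rfl

theorem val_tuple {n : ℕ} {A : Fin n → VTy Op} (V : ∀ i, Val Γ (A i)) :
    𝓜.val (.tuple V) =
      Fan.IsLimit.lift (𝓜.tup fun i => 𝓜.ty (A i)).isLimit fun i => 𝓜.val (V i) := by
  simp only [val]; rfl

theorem val_proj {n : ℕ} {A : Fin n → VTy Op} (i : Fin n) (V : Val Γ (.prod A)) :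
    𝓜.val (.proj i V) = 𝓜.val V ≫ Fan.proj (𝓜.tup fun i => 𝓜.ty (A i)).cone i := by
  simp only [val]

theorem val_inl {A B : VTy Op} (V : Val Γ A) :
    𝓜.val (.inl (B := B) V) = 𝓜.val V ≫ 𝓜.inl (𝓜.ty A) (𝓜.ty B) := by
  simp only [val]; rfl

theorem val_inr {A B : VTy Op} (V : Val Γ B) :
    𝓜.val (.inr (A := A) V) = 𝓜.val V ≫ 𝓜.inr (𝓜.ty A) (𝓜.ty B) := by
  simp only [val]; rfl

theorem comp_app {A : VTy Op} {D : CTy Op} (V : Val Γ (A.fn D)) (W : Val Γ A) :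
    𝓜.comp (.app V W) =
      lift (Y := 𝓜.ty A) (𝓜.val V) (𝓜.val W) ≫
        (𝓜.kexp (𝓜.sig D.sig) (𝓜.ty A) (𝓜.ty D.val)).eval := by
  simp only [comp]; rfl

theorem comp_ret {A : VTy Op} {S : Sig Op (VTy Op)} (V : Val Γ A) :
    𝓜.comp (.ret (S := S) V) = 𝓜.val V ≫ (𝓜.T (𝓜.sig S)).η.app (𝓜.ty A) := by
  simp only [comp]; rfl

theorem comp_letin {A B : VTy Op} {S : Sig Op (VTy Op)} (M : Comp Γ ⟨A, S⟩)
    (N : Comp (A :: Γ) ⟨B, S⟩) :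
    𝓜.comp (.letin M N) = (𝓜.T (𝓜.sig S)).bindWith (X := 𝓜.ctx Γ) (A := 𝓜.ty A) (B := 𝓜.ty B)
      (𝓜.comp M) (𝓜.comp N) := by
  simp only [comp]; rfl

theorem comp_op {S : Sig Op (VTy Op)} (o : {o // o ∈ S.dom}) (V : Val Γ (S.arg o)) :
    𝓜.comp (.op o V) = 𝓜.val V ≫ 𝓜.op (𝓜.sig S) o := by
  simp only [comp]; rfl

theorem hdl_eq {S : Sig Op (VTy Op)} {D : CTy Op} (H : Hdl Γ S D) :
    𝓜.hdl H = 𝓜.hdlOf (𝓜.sig S) (𝓜.sig D.sig) (𝓜.ty D.val) (Z := 𝓜.ctx Γ)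
      fun o => 𝓜.comp (H o) := rfl

theorem comp_handle {A : VTy Op} {S : Sig Op (VTy Op)} {D : CTy Op} (M : Comp Γ ⟨A, S⟩)
    (H : Hdl Γ S D) (N : Comp (A :: Γ) D) :
    𝓜.comp (.handle M H N) = 𝓜.handleWith (𝓜.sig S) (𝓜.sig D.sig) (X := 𝓜.ctx Γ)
      (A := 𝓜.ty A) (B := 𝓜.ty D.val) (𝓜.hdl H) (𝓜.comp M) (𝓜.comp N) := by
  simp only [comp]; rfl

theorem comp_case {A B : VTy Op} {D : CTy Op} (V : Val Γ (.sum A B)) (M : Comp (A :: Γ) D)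
    (N : Comp (B :: Γ) D) :
    𝓜.comp (.case V M N) = lift (Y := 𝓜.sum (𝓜.ty A) (𝓜.ty B)) (𝟙 (𝓜.ctx Γ)) (𝓜.val V) ≫
      𝓜.copair (𝓜.sig D.sig) (Z := 𝓜.ctx Γ) (W := 𝓜.ty D.val) (𝓜.comp M) (𝓜.comp N) := by
  simp only [comp]; rfl

/-! ## Interpretation of substituted terms -/

theorem comp_val_tuple {n : ℕ} {A : Fin n → VTy Op} (f : 𝓜.ctx Δ ⟶ 𝓜.ctx Γ) (V : ∀ i, Val Γ (A i)) :
    f ≫ 𝓜.val (.tuple V) =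
      Fan.IsLimit.lift (𝓜.tup fun i => 𝓜.ty (A i)).isLimit fun i => f ≫ 𝓜.val (V i) := by
  let t := (𝓜.tup fun i => 𝓜.ty (A i)).isLimit
  rw [val_tuple]
  refine Fan.IsLimit.hom_ext t _ _ fun i => (Category.assoc _ _ _).trans ?_
  exact (congrArg (f ≫ ·) (Fan.IsLimit.fac t (fun i => 𝓜.val (V i)) i)).trans
    (Fan.IsLimit.fac t (fun i => f ≫ 𝓜.val (V i)) i).symm

/-- The extension of a morphism between contexts by a variable. -/
def ctxMap (f : 𝓜.ctx Δ ⟶ 𝓜.ctx Γ) (B : VTy Op) : 𝓜.ctx (B :: Δ) ⟶ 𝓜.ctx (B :: Γ) := f ▷ 𝓜.ty B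

/-- A class `R` of pairs of a substitution and a morphism between contexts whose components agree,
closed under extension by a variable. On such a class the morphism interprets the substitution on
all terms; one instance for renamings gives the weakening needed for the instance for all
substitutions. -/
structure InterpClass (R : ∀ {Γ Δ : Ctx Op}, Subst Γ Δ → (𝓜.ctx Δ ⟶ 𝓜.ctx Γ) → Prop) : Prop where
  val_app : ∀ {Γ Δ : Ctx Op} {σ : Subst Γ Δ} {f : 𝓜.ctx Δ ⟶ 𝓜.ctx Γ}, R σ f →
    ∀ {A : VTy Op} (x : Var Γ A), 𝓜.val (σ x) = f ≫ 𝓜.var x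
  lift : ∀ {Γ Δ : Ctx Op} {σ : Subst Γ Δ} {f : 𝓜.ctx Δ ⟶ 𝓜.ctx Γ}, R σ f →
    ∀ B, R (σ.lift B) (𝓜.ctxMap f B)

variable {𝓜}

theorem hdl_eq_comp_hdl {S : Sig Op (VTy Op)} {D : CTy Op} {H : Hdl Γ S D} {H' : Hdl Δ S D}
    {f : 𝓜.ctx Δ ⟶ 𝓜.ctx Γ}
    (h : ∀ o, 𝓜.comp (H' o) = 𝓜.ctxMap (𝓜.ctxMap f _) _ ≫ 𝓜.comp (H o)) :
    𝓜.hdl H' = f ≫ 𝓜.hdl H := by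
  rw [hdl_eq, hdl_eq]
  exact .trans (congrArg _ (funext h)) (EffFrame.comp_hdlOf _ _ _ _ f _).symm

namespace InterpClass

variable {R : ∀ {Γ Δ : Ctx Op}, Subst Γ Δ → (𝓜.ctx Δ ⟶ 𝓜.ctx Γ) → Prop}

mutual

theorem val_subst (hR : 𝓜.InterpClass R) {Γ Δ : Ctx Op} {A : VTy Op} {σ : Subst Γ Δ}
    {f : 𝓜.ctx Δ ⟶ 𝓜.ctx Γ} (h : R σ f) : (V : Val Γ A) → 𝓜.val (V.subst σ) = f ≫ 𝓜.val V
  | .var x => by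
    rw [Val.subst, val_var]
    exact hR.val_app h x
  | .lam M => by
    rw [Val.subst, val_lam, val_lam, hR.comp_subst (hR.lift h _) M]
    exact KleisliExp.curry_natural _ f _
  | .tuple V => by
    rw [Val.subst, val_tuple, comp_val_tuple, funext fun i => hR.val_subst h (V i)]
  | .proj (A := _) i V => by
    rw [Val.subst, val_proj, val_proj, hR.val_subst h V]
    exact Category.assoc _ _ _
  | .inl V => by
    rw [Val.subst, val_inl, val_inl, hR.val_subst h V]
    exact Category.assoc _ _ _
  | .inr V => by
    rw [Val.subst, val_inr, val_inr, hR.val_subst h V]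
    exact Category.assoc _ _ _

theorem comp_subst (hR : 𝓜.InterpClass R) {Γ Δ : Ctx Op} {D : CTy Op} {σ : Subst Γ Δ}
    {f : 𝓜.ctx Δ ⟶ 𝓜.ctx Γ} (h : R σ f) : (M : Comp Γ D) → 𝓜.comp (M.subst σ) = f ≫ 𝓜.comp M
  | .app V W => by
    rw [Comp.subst, comp_app, comp_app, hR.val_subst h V, hR.val_subst h W]
    exact (comp_lift_assoc f _ _ _).symm
  | .ret V => by
    rw [Comp.subst, comp_ret, comp_ret, hR.val_subst h V]
    exact Category.assoc _ _ _
  | .letin M N => by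
    rw [Comp.subst, comp_letin, comp_letin, hR.comp_subst h M, hR.comp_subst (hR.lift h _) N]
    exact (StrongMonad.comp_bindWith _ f _ _).symm
  | .op o V => by
    rw [Comp.subst, comp_op, comp_op, hR.val_subst h V]
    exact Category.assoc _ _ _
  | .handle M H N => by
    rw [Comp.subst, comp_handle, comp_handle, hR.comp_subst h M,
      hdl_eq_comp_hdl fun o => hR.comp_subst (hR.lift (hR.lift h _) _) (H o),
      hR.comp_subst (hR.lift h _) N]
    exact (EffModel.comp_handleWith _ _ _ f _ _ _).symm
  | .case V M N => by
    rw [Comp.subst, comp_case, comp_case, hR.val_subst h V, hR.comp_subst (hR.lift h _) M,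
      hR.comp_subst (hR.lift h _) N]
    exact (𝓜.comp_lift_copair _ f _ _ _).symm

end

end InterpClass

variable (𝓜) in
/-- The morphism `f` is the tuple of the interpretations of the components of `σ`. -/
def IsSubst (σ : Subst Γ Δ) (f : 𝓜.ctx Δ ⟶ 𝓜.ctx Γ) : Prop :=
  ∀ ⦃A : VTy Op⦄ (x : Var Γ A), 𝓜.val (σ x) = f ≫ 𝓜.var x

theorem isSubst_lift_of_weaken {σ : Subst Γ Δ} {f : 𝓜.ctx Δ ⟶ 𝓜.ctx Γ} (h : 𝓜.IsSubst σ f)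
    {B : VTy Op} (hB : ∀ ⦃A : VTy Op⦄ (x : Var Γ A),
      𝓜.val ((σ x).weaken B) = fst (𝓜.ctx Δ) (𝓜.ty B) ≫ 𝓜.val (σ x)) :
    𝓜.IsSubst (σ.lift B) (𝓜.ctxMap f B)
  | _, .zero => (𝓜.val_var _).trans (whiskerRight_snd f (𝓜.ty B)).symm
  | _, .succ x => ((hB x).trans (congrArg (fst (𝓜.ctx Δ) (𝓜.ty B) ≫ ·) (h x))).trans
      (whiskerRight_fst_assoc f (𝓜.ty B) (𝓜.var x)).symm

theorem interpClass_toSubst : 𝓜.InterpClass fun {Γ Δ : Ctx Op} (σ : Subst Γ Δ) f =>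
    (∃ ρ : Ren Γ Δ, σ = ρ.toSubst) ∧ 𝓜.IsSubst σ f where
  val_app h _ x := h.2 x
  lift := by
    rintro Γ Δ _ f ⟨⟨ρ, rfl⟩, h⟩ B
    refine ⟨⟨ρ.lift B, (ρ.toSubst_lift B).symm⟩, isSubst_lift_of_weaken h fun A x => ?_⟩
    rw [Ren.toSubst, Val.weaken, Val.rename, val_var, val_var, var]
    rfl

theorem isSubst_wk (Γ : Ctx Op) (B : VTy Op) :
    𝓜.IsSubst (Subst.wk Γ B) (fst (𝓜.ctx Γ) (𝓜.ty B)) :=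
  fun _ _ => 𝓜.val_var _

theorem val_weaken {A : VTy Op} (V : Val Γ A) (B : VTy Op) :
    𝓜.val (V.weaken B) = fst (𝓜.ctx Γ) (𝓜.ty B) ≫ 𝓜.val V := by
  rw [Val.weaken_eq_subst]
  exact interpClass_toSubst.val_subst ⟨⟨_, rfl⟩, isSubst_wk Γ B⟩ V

theorem interpClass_isSubst : 𝓜.InterpClass 𝓜.IsSubst where
  val_app h _ x := h x
  lift h _ := isSubst_lift_of_weaken h fun _ _ => val_weaken _ _

namespace IsSubst

variable {σ : Subst Γ Δ} {f : 𝓜.ctx Δ ⟶ 𝓜.ctx Γ}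

theorem lift (h : 𝓜.IsSubst σ f) (B : VTy Op) : 𝓜.IsSubst (σ.lift B) (𝓜.ctxMap f B) :=
  interpClass_isSubst.lift h B

theorem comp_subst {D : CTy Op} (h : 𝓜.IsSubst σ f) (M : Comp Γ D) :
    𝓜.comp (M.subst σ) = f ≫ 𝓜.comp M :=
  interpClass_isSubst.comp_subst h M

theorem cons (h : 𝓜.IsSubst σ f) {B : VTy Op} (V : Val Δ B) :
    𝓜.IsSubst (σ.cons V) (CartesianMonoidalCategory.lift f (𝓜.val V))
  | _, .zero => (lift_snd f (𝓜.val V)).symm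
  | _, .succ x => (h x).trans (lift_fst_assoc f (𝓜.val V) (𝓜.var x)).symm

end IsSubst

theorem isSubst_id (Γ : Ctx Op) : 𝓜.IsSubst (Subst.id Γ) (𝟙 (𝓜.ctx Γ)) :=
  fun _ x => (𝓜.val_var x).trans (Category.id_comp _).symm

theorem comp_inst {A : VTy Op} {D : CTy Op} (M : Comp (A :: Γ) D) (V : Val Γ A) :
    𝓜.comp (M.inst V) = lift (𝟙 (𝓜.ctx Γ)) (𝓜.val V) ≫ 𝓜.comp M :=
  ((isSubst_id Γ).cons V).comp_subst M

theorem comp_inst₂ {A B : VTy Op} {D : CTy Op} (M : Comp (B :: A :: Γ) D) (V : Val Γ A)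
    (W : Val Γ B) :
    𝓜.comp (M.inst₂ V W) = lift (lift (𝟙 (𝓜.ctx Γ)) (𝓜.val V)) (𝓜.val W) ≫ 𝓜.comp M :=
  (((isSubst_id Γ).cons V).cons W).comp_subst M

theorem comp_weakenUnder {A : VTy Op} {D : CTy Op} (M : Comp (A :: Γ) D) (B : VTy Op) :
    𝓜.comp (M.weakenUnder B) = fst (𝓜.ctx Γ) (𝓜.ty B) ▷ 𝓜.ty A ≫ 𝓜.comp M := by
  rw [Comp.weakenUnder_eq_subst]
  exact ((isSubst_wk Γ B).lift A).comp_subst M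

theorem hdl_weaken {S : Sig Op (VTy Op)} {D : CTy Op} (H : Hdl Γ S D) (B : VTy Op) :
    𝓜.hdl (H.weaken B) = fst (𝓜.ctx Γ) (𝓜.ty B) ≫ 𝓜.hdl H := by
  refine hdl_eq_comp_hdl fun o => ?_
  rw [Hdl.weaken_eq_subst]
  exact (((isSubst_wk Γ B).lift _).lift _).comp_subst (H o)

theorem comp_replace {A B : VTy Op} {D : CTy Op} (M : Comp (A :: Γ) D) (V : Val (B :: Γ) A) :
    𝓜.comp (M.replace V) = lift (fst (𝓜.ctx Γ) (𝓜.ty B)) (𝓜.val V) ≫ 𝓜.comp M :=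
  ((isSubst_wk Γ B).cons V).comp_subst M

variable (𝓜)

/-! ## Soundness -/

section Laws

variable {A B : VTy Op} {D : CTy Op} {S : Sig Op (VTy Op)}

theorem val_lam_eta (V : Val Γ (A.fn D)) :
    𝓜.val V = 𝓜.val (.lam (.app (V.weaken A) (.var .zero))) := by
  rw [val_lam, comp_app, val_weaken, val_var]
  have h (X Y Z : C) (f : X ⟶ Z) : f ▷ Y = lift (fst X Y ≫ f) (snd X Y) := by ext <;> simp
  let K := 𝓜.kexp (𝓜.sig D.sig) (𝓜.ty A) (𝓜.ty D.val)
  refine (KleisliExp.curry_eval K (𝓜.val V)).symm.trans ?_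
  exact congrArg K.curry (congrArg (· ≫ K.eval) (h _ _ _ _))

theorem val_prod_beta {n : ℕ} {A : Fin n → VTy Op} (V : ∀ i, Val Γ (A i)) (i : Fin n) :
    𝓜.val (.proj i (.tuple V)) = 𝓜.val (V i) := by
  rw [val_proj, val_tuple]
  exact Fan.IsLimit.fac (𝓜.tup fun i => 𝓜.ty (A i)).isLimit (fun i => 𝓜.val (V i)) i

theorem val_prod_eta {n : ℕ} {A : Fin n → VTy Op} (V : Val Γ (.prod A)) :
    𝓜.val V = 𝓜.val (.tuple fun i => .proj i V) := by
  rw [val_tuple]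
  refine Fan.IsLimit.hom_ext (𝓜.tup fun i => 𝓜.ty (A i)).isLimit _ _ fun i => ?_
  refine .trans ?_ (Fan.IsLimit.fac (𝓜.tup fun i => 𝓜.ty (A i)).isLimit _ i).symm
  exact (𝓜.val_proj i V).symm

theorem comp_lam_beta (M : Comp (A :: Γ) D) (V : Val Γ A) :
    𝓜.comp (.app (.lam M) V) = 𝓜.comp (M.inst V) := by
  rw [comp_app, val_lam, comp_inst]
  exact KleisliExp.lift_curry_eval _ _ _

theorem comp_ret_let (V : Val Γ A) (M : Comp (A :: Γ) ⟨B, S⟩) :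
    𝓜.comp (.letin (.ret V) M) = 𝓜.comp (M.inst V) := by
  rw [comp_letin, comp_ret, comp_inst]
  exact StrongMonad.bindWith_unit _ _ _

theorem comp_let_ret (M : Comp Γ ⟨A, S⟩) :
    𝓜.comp (.letin M (.ret (.var .zero))) = 𝓜.comp M := by
  rw [comp_letin, comp_ret, val_var]
  exact StrongMonad.bindWith_snd_unit _ _

theorem comp_let_let {A₁ A₂ A₃ : VTy Op} (M : Comp Γ ⟨A₁, S⟩) (N : Comp (A₁ :: Γ) ⟨A₂, S⟩)
    (L : Comp (A₂ :: Γ) ⟨A₃, S⟩) :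
    𝓜.comp (.letin (.letin M N) L) = 𝓜.comp (.letin M (.letin N (L.weakenUnder A₁))) := by
  rw [comp_letin, comp_letin, comp_letin, comp_letin, comp_weakenUnder]
  exact StrongMonad.bindWith_bindWith _ _ _ _

theorem comp_handle_ret (V : Val Γ A) (H : Hdl Γ S D) (M : Comp (A :: Γ) D) :
    𝓜.comp (.handle (.ret V) H M) = 𝓜.comp (M.inst V) := by
  rw [comp_handle, comp_ret, comp_inst]
  exact EffModel.handleWith_unit _ _ _ _ _ _

theorem comp_handle_let (L : Comp Γ ⟨A, S⟩) (M : Comp (A :: Γ) ⟨B, S⟩) (H : Hdl Γ S D)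
    (N : Comp (B :: Γ) D) :
    𝓜.comp (.handle (.letin L M) H N) =
      𝓜.comp (.handle L H (.handle M (Hdl.weaken H A) (N.weakenUnder A))) := by
  rw [comp_handle, comp_letin, comp_handle, comp_handle, hdl_weaken, comp_weakenUnder]
  exact EffModel.handleWith_bindWith _ _ _ _ _ _ _

theorem comp_handle_op (o : {o // o ∈ S.dom}) (V : Val Γ (S.arg o)) (H : Hdl Γ S D)
    (M : Comp (S.res o :: Γ) D) :
    𝓜.comp (.handle (.op o V) H M) = 𝓜.comp ((H o).inst₂ V (.lam M)) := by
  rw [comp_handle, comp_op, comp_inst₂, val_lam, hdl_eq]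
  exact EffModel.handleWith_op _ _ _ _ _ _ _

theorem comp_case_inl (V : Val Γ A) (M : Comp (A :: Γ) D) (N : Comp (B :: Γ) D) :
    𝓜.comp (.case (.inl V) M N) = 𝓜.comp (M.inst V) := by
  rw [comp_case, val_inl, comp_inst]
  exact 𝓜.lift_inl_copair _ _ _ _

theorem comp_case_inr (V : Val Γ B) (M : Comp (A :: Γ) D) (N : Comp (B :: Γ) D) :
    𝓜.comp (.case (.inr V) M N) = 𝓜.comp (N.inst V) := by
  rw [comp_case, val_inr, comp_inst]
  exact 𝓜.lift_inr_copair _ _ _ _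

theorem comp_case_eta (V : Val Γ (.sum A B)) (M : Comp (.sum A B :: Γ) D) :
    𝓜.comp (.case V (M.replace (.inl (.var .zero))) (M.replace (.inr (.var .zero)))) =
      𝓜.comp (M.inst V) := by
  have h (X Y Z : C) (f : Y ⟶ Z) : lift (fst X Y) (snd X Y ≫ f) = X ◁ f := by
    ext <;> simp
  rw [comp_case, comp_inst, comp_replace, comp_replace, val_inl, val_inr, val_var, val_var]
  refine congrArg (_ ≫ ·) (.trans ?_ (𝓜.copair_comp _ _))
  exact congrArg₂ (𝓜.copair _) (congrArg (· ≫ _) (h _ _ _ _)) (congrArg (· ≫ _) (h _ _ _ _))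

end Laws

mutual

theorem val_eq_of_valEq {Γ : Ctx Op} {A : VTy Op} {V W : Val Γ A} : ValEq V W → 𝓜.val V = 𝓜.val W
  | .refl _ => rfl
  | .symm h => (val_eq_of_valEq h).symm
  | .trans h h' => (val_eq_of_valEq h).trans (val_eq_of_valEq h')
  | .lam_congr h => by rw [val_lam, val_lam, comp_eq_of_compEq h]
  | .tuple_congr h => by rw [val_tuple, val_tuple, funext fun i => val_eq_of_valEq (h i)]
  | .proj_congr (A := _) i h => by rw [val_proj, val_proj, val_eq_of_valEq h]
  | .inl_congr h => by rw [val_inl, val_inl, val_eq_of_valEq h]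
  | .inr_congr h => by rw [val_inr, val_inr, val_eq_of_valEq h]
  | .lam_eta V => 𝓜.val_lam_eta V
  | .prod_beta (A := _) V i => 𝓜.val_prod_beta V i
  | .prod_eta V => 𝓜.val_prod_eta V

theorem comp_eq_of_compEq {Γ : Ctx Op} {D : CTy Op} {M N : Comp Γ D} :
    CompEq M N → 𝓜.comp M = 𝓜.comp N
  | .refl _ => rfl
  | .symm h => (comp_eq_of_compEq h).symm
  | .trans h h' => (comp_eq_of_compEq h).trans (comp_eq_of_compEq h')
  | .app_congr h h' => by rw [comp_app, comp_app, val_eq_of_valEq h, val_eq_of_valEq h']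
  | .ret_congr h => by rw [comp_ret, comp_ret, val_eq_of_valEq h]
  | .letin_congr h h' => by rw [comp_letin, comp_letin, comp_eq_of_compEq h, comp_eq_of_compEq h']
  | .op_congr o h => by rw [comp_op, comp_op, val_eq_of_valEq h]
  | .handle_congr h h' h'' => by
    rw [comp_handle, comp_handle, comp_eq_of_compEq h, hdl_eq_of_hdlEq h', comp_eq_of_compEq h'']
  | .case_congr h h' h'' => by
    rw [comp_case, comp_case, val_eq_of_valEq h, comp_eq_of_compEq h', comp_eq_of_compEq h'']
  | .lam_beta M V => 𝓜.comp_lam_beta M V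
  | .ret_let V M => 𝓜.comp_ret_let V M
  | .let_ret M => 𝓜.comp_let_ret M
  | .let_let M N L => 𝓜.comp_let_let M N L
  | .handle_ret V H M => 𝓜.comp_handle_ret V H M
  | .handle_let L M H N => 𝓜.comp_handle_let L M H N
  | .handle_op o V H M => 𝓜.comp_handle_op o V H M
  | .case_inl V M N => 𝓜.comp_case_inl V M N
  | .case_inr V M N => 𝓜.comp_case_inr V M N
  | .case_eta V M => 𝓜.comp_case_eta V M

theorem hdl_eq_of_hdlEq {Γ : Ctx Op} {S : Sig Op (VTy Op)} {D : CTy Op} {H H' : Hdl Γ S D} :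
    HdlEq H H' → 𝓜.hdl H = 𝓜.hdl H'
  | .refl _ => rfl
  | .symm h => (hdl_eq_of_hdlEq h).symm
  | .trans h h' => (hdl_eq_of_hdlEq h).trans (hdl_eq_of_hdlEq h')
  | .congr h => by rw [hdl_eq, hdl_eq]; exact congrArg _ (funext fun o => comp_eq_of_compEq (h o))

end

theorem comp_eq_of_hdl_eq {Γ : Ctx Op} {S : Sig Op (VTy Op)} {D : CTy Op} {H H' : Hdl Γ S D}
    (h : 𝓜.hdl H = 𝓜.hdl H') (o : {o // o ∈ S.dom}) : 𝓜.comp (H o) = 𝓜.comp (H' o) :=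
  (cancel_epi (α_ _ _ _).inv).1 ((𝓜.kexp _ _ _).curry.injective
    (congrFun (𝓜.hdlLift_injective _ _ _ _ h) o))

end EffPlusModel

end

section Quotient

variable {Op : Type w} {Γ Δ Θ Ξ : Ctx Op} {A B : VTy Op} {C : CTy Op} {S : Sig Op (VTy Op)}
  {n : ℕ} {F : Fin n → VTy Op}

/-! ## Terms modulo derivable equality -/

/-- Derivable equality of value terms. -/
instance Val.setoid (Γ : Ctx Op) (A : VTy Op) : Setoid (Val Γ A) where
  r := ValEq
  iseqv := ⟨.refl, .symm, .trans⟩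

/-- Derivable equality of computation terms. -/
instance Comp.setoid (Γ : Ctx Op) (C : CTy Op) : Setoid (Comp Γ C) where
  r := CompEq
  iseqv := ⟨.refl, .symm, .trans⟩

/-- Value terms modulo derivable equality. -/
def QVal (Γ : Ctx Op) (A : VTy Op) : Type w := Quotient (Val.setoid Γ A)

/-- Computation terms modulo derivable equality. -/
def QComp (Γ : Ctx Op) (C : CTy Op) : Type w := Quotient (Comp.setoid Γ C)

/-- Handlers whose clauses are classes of computation terms. -/
abbrev QHdl (Γ : Ctx Op) (S : Sig Op (VTy Op)) (C : CTy Op) : Type w :=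
  ∀ o : {o // o ∈ S.dom}, QComp ((S.res o).fn C :: S.arg o :: Γ) C

/-- Substitutions of classes of value terms in context `Δ` for the variables in `Γ`. -/
def QSubst (Γ Δ : Ctx Op) : Type w := ∀ A : VTy Op, Var Γ A → QVal Δ A

/-- The class of a value term. -/
def Val.cls (V : Val Γ A) : QVal Γ A := Quotient.mk _ V

/-- The class of a computation term. -/
def Comp.cls (M : Comp Γ C) : QComp Γ C := Quotient.mk _ M

/-- The pointwise class of a substitution. -/
def Subst.cls (σ : Subst Γ Δ) : QSubst Γ Δ := fun _ x => (σ x).cls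

theorem Val.cls_eq {V W : Val Γ A} : V.cls = W.cls ↔ ValEq V W := Quotient.eq

theorem Comp.cls_eq {M N : Comp Γ C} : M.cls = N.cls ↔ CompEq M N := Quotient.eq

theorem QVal.exists_cls (v : QVal Γ A) : ∃ V : Val Γ A, V.cls = v := Quotient.exists_rep v

theorem QComp.exists_cls (m : QComp Γ C) : ∃ M : Comp Γ C, M.cls = m := Quotient.exists_rep m

theorem QVal.exists_cls_tuple (v : ∀ i, QVal Γ (F i)) :
    ∃ V : ∀ i, Val Γ (F i), (fun i => (V i).cls) = v := by
  choose V hV using fun i => (v i).exists_cls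
  exact ⟨V, funext hV⟩

theorem QHdl.exists_cls (h : QHdl Γ S C) : ∃ H : Hdl Γ S C, (fun o => (H o).cls) = h := by
  choose H hH using fun o => (h o).exists_cls
  exact ⟨H, funext hH⟩

theorem QSubst.exists_cls (σ : QSubst Γ Δ) : ∃ τ : Subst Γ Δ, τ.cls = σ := by
  choose τ hτ using fun (A : VTy Op) (x : Var Γ A) => (σ A x).exists_cls
  exact ⟨τ, funext fun A => funext (hτ A)⟩

noncomputable section

/-- A representative of a class of value terms. The constructors below act on chosen representatives
because tuples and handlers take families of classes, to which no function on families of terms can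
be lifted constructively. -/
def QVal.rep (v : QVal Γ A) : Val Γ A := Quotient.out v

/-- A representative of a class of computation terms. -/
def QComp.rep (m : QComp Γ C) : Comp Γ C := Quotient.out m

theorem Val.rep_cls (V : Val Γ A) : ValEq V.cls.rep V := Val.cls_eq.1 (Quotient.out_eq _)

theorem Comp.rep_cls (M : Comp Γ C) : CompEq M.cls.rep M := Comp.cls_eq.1 (Quotient.out_eq _)

namespace QVal

/-- The class of a variable. -/
def var (x : Var Γ A) : QVal Γ A := (Val.var x).cls

/-- Abstraction on classes. -/
def lam (m : QComp (A :: Γ) C) : QVal Γ (A.fn C) := (Val.lam m.rep).cls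

/-- Tupling on classes. -/
def tuple (v : ∀ i, QVal Γ (F i)) : QVal Γ (.prod F) := (Val.tuple fun i => (v i).rep).cls

/-- Projections on classes. -/
def proj (i : Fin n) (v : QVal Γ (.prod F)) : QVal Γ (F i) := (Val.proj i v.rep).cls

/-- The first injection on classes. -/
def inl (v : QVal Γ A) : QVal Γ (.sum A B) := (Val.inl v.rep).cls

/-- The second injection on classes. -/
def inr (v : QVal Γ B) : QVal Γ (.sum A B) := (Val.inr v.rep).cls

/-- Substitution on classes. -/
def subst (v : QVal Γ A) (σ : QSubst Γ Δ) : QVal Δ A :=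
  (v.rep.subst fun A x => (σ A x).rep).cls

end QVal

namespace QComp

/-- Application on classes. -/
def app (v : QVal Γ (A.fn C)) (w : QVal Γ A) : QComp Γ C := (Comp.app v.rep w.rep).cls

/-- `return` on classes. -/
def ret (v : QVal Γ A) : QComp Γ ⟨A, S⟩ := (Comp.ret v.rep).cls

/-- `let` on classes. -/
def letin (m : QComp Γ ⟨A, S⟩) (n : QComp (A :: Γ) ⟨B, S⟩) : QComp Γ ⟨B, S⟩ :=
  (Comp.letin m.rep n.rep).cls

/-- Operation calls on classes. -/
def op (o : {o // o ∈ S.dom}) (v : QVal Γ (S.arg o)) : QComp Γ ⟨S.res o, S⟩ := (Comp.op o v.rep).cls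

/-- `handle` on classes. -/
def handle (m : QComp Γ ⟨A, S⟩) (h : QHdl Γ S C) (n : QComp (A :: Γ) C) : QComp Γ C :=
  (Comp.handle m.rep (fun o => (h o).rep) n.rep).cls

/-- `case` on classes. -/
def case (v : QVal Γ (.sum A B)) (m : QComp (A :: Γ) C) (n : QComp (B :: Γ) C) : QComp Γ C :=
  (Comp.case v.rep m.rep n.rep).cls

/-- Substitution on classes. -/
def subst (m : QComp Γ C) (σ : QSubst Γ Δ) : QComp Δ C :=
  (m.rep.subst fun A x => (σ A x).rep).cls

end QComp

namespace QSubst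

/-- The identity substitution. -/
def id (Γ : Ctx Op) : QSubst Γ Γ := fun _ x => .var x

/-- The weakening substitution. -/
def wk (Γ : Ctx Op) (B : VTy Op) : QSubst Γ (B :: Γ) := fun _ x => .var (.succ x)

/-- Extension of a substitution by a class for the last variable. -/
def cons (σ : QSubst Γ Δ) (v : QVal Δ B) : QSubst (B :: Γ) Δ
  | _, .zero => v
  | _, .succ x => σ _ x

/-- Composition of substitutions in diagrammatic order. -/
def comp (σ : QSubst Γ Δ) (τ : QSubst Δ Θ) : QSubst Γ Θ := fun A x => (σ A x).subst τ

/-- The lift of a substitution under a binder. -/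
def lift (σ : QSubst Γ Δ) (B : VTy Op) : QSubst (B :: Γ) (B :: Δ) :=
  (σ.comp (wk Δ B)).cons (.var .zero)

end QSubst

end

namespace Val

theorem cls_var (x : Var Γ A) : (Val.var x).cls = .var x := rfl

theorem cls_lam (M : Comp (A :: Γ) C) : (Val.lam M).cls = .lam M.cls :=
  Val.cls_eq.2 (.symm (.lam_congr M.rep_cls))

theorem cls_tuple (V : ∀ i, Val Γ (F i)) : (Val.tuple V).cls = .tuple fun i => (V i).cls :=
  Val.cls_eq.2 (.symm (.tuple_congr fun i => (V i).rep_cls))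

theorem cls_proj (i : Fin n) (V : Val Γ (.prod F)) : (Val.proj i V).cls = .proj i V.cls :=
  Val.cls_eq.2 (.symm (.proj_congr i V.rep_cls))

theorem cls_inl (V : Val Γ A) : (Val.inl (B := B) V).cls = .inl V.cls :=
  Val.cls_eq.2 (.symm (.inl_congr V.rep_cls))

theorem cls_inr (V : Val Γ B) : (Val.inr (A := A) V).cls = .inr V.cls :=
  Val.cls_eq.2 (.symm (.inr_congr V.rep_cls))

end Val

namespace Comp

theorem cls_app (V : Val Γ (A.fn C)) (W : Val Γ A) : (Comp.app V W).cls = .app V.cls W.cls :=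
  Comp.cls_eq.2 (.symm (.app_congr V.rep_cls W.rep_cls))

theorem cls_ret (V : Val Γ A) : (Comp.ret (S := S) V).cls = .ret V.cls :=
  Comp.cls_eq.2 (.symm (.ret_congr V.rep_cls))

theorem cls_letin (M : Comp Γ ⟨A, S⟩) (N : Comp (A :: Γ) ⟨B, S⟩) :
    (Comp.letin M N).cls = .letin M.cls N.cls :=
  Comp.cls_eq.2 (.symm (.letin_congr M.rep_cls N.rep_cls))

theorem cls_op (o : {o // o ∈ S.dom}) (V : Val Γ (S.arg o)) : (Comp.op o V).cls = .op o V.cls :=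
  Comp.cls_eq.2 (.symm (.op_congr o V.rep_cls))

theorem cls_handle (M : Comp Γ ⟨A, S⟩) (H : Hdl Γ S C) (N : Comp (A :: Γ) C) :
    (Comp.handle M H N).cls = .handle M.cls (fun o => (H o).cls) N.cls :=
  Comp.cls_eq.2 (.symm (.handle_congr M.rep_cls (.congr fun o => (H o).rep_cls) N.rep_cls))

theorem cls_case (V : Val Γ (.sum A B)) (M : Comp (A :: Γ) C) (N : Comp (B :: Γ) C) :
    (Comp.case V M N).cls = .case V.cls M.cls N.cls :=
  Comp.cls_eq.2 (.symm (.case_congr V.rep_cls M.rep_cls N.rep_cls))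

end Comp

theorem Subst.lift_valEq {σ τ : Subst Γ Δ} (h : ∀ (A : VTy Op) (x : Var Γ A), ValEq (σ x) (τ x))
    (B : VTy Op) : ∀ (A : VTy Op) (x : Var (B :: Γ) A), ValEq (σ.lift B x) (τ.lift B x)
  | _, .zero => .refl _
  | _, .succ x => by
    simpa only [Subst.lift, Val.weaken_eq_subst] using (h _ x).subst (Subst.wk Δ B)

mutual

theorem Val.subst_valEq {Γ Δ : Ctx Op} {A : VTy Op} {σ τ : Subst Γ Δ}
    (h : ∀ (A : VTy Op) (x : Var Γ A), ValEq (σ x) (τ x)) :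
    (V : Val Γ A) → ValEq (V.subst σ) (V.subst τ)
  | .var x => by simpa only [Val.subst] using h _ x
  | .lam M => by simpa only [Val.subst] using .lam_congr (M.subst_compEq (Subst.lift_valEq h _))
  | .tuple V => by simpa only [Val.subst] using .tuple_congr fun i => (V i).subst_valEq h
  | .proj (A := _) i V => by simpa only [Val.subst] using .proj_congr i (V.subst_valEq h)
  | .inl V => by simpa only [Val.subst] using .inl_congr (V.subst_valEq h)
  | .inr V => by simpa only [Val.subst] using .inr_congr (V.subst_valEq h)

theorem Comp.subst_compEq {Γ Δ : Ctx Op} {C : CTy Op} {σ τ : Subst Γ Δ}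
    (h : ∀ (A : VTy Op) (x : Var Γ A), ValEq (σ x) (τ x)) :
    (M : Comp Γ C) → CompEq (M.subst σ) (M.subst τ)
  | .app V W => by simpa only [Comp.subst] using .app_congr (V.subst_valEq h) (W.subst_valEq h)
  | .ret V => by simpa only [Comp.subst] using .ret_congr (V.subst_valEq h)
  | .letin M N => by
    simpa only [Comp.subst] using
      .letin_congr (M.subst_compEq h) (N.subst_compEq (Subst.lift_valEq h _))
  | .op o V => by simpa only [Comp.subst] using .op_congr o (V.subst_valEq h)
  | .handle M H N => by
    simpa only [Comp.subst] using
      .handle_congr (M.subst_compEq h)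
        (.congr fun o => (H o).subst_compEq (Subst.lift_valEq (Subst.lift_valEq h _) _))
        (N.subst_compEq (Subst.lift_valEq h _))
  | .case V M N => by
    simpa only [Comp.subst] using
      .case_congr (V.subst_valEq h) (M.subst_compEq (Subst.lift_valEq h _))
        (N.subst_compEq (Subst.lift_valEq h _))

end

theorem Val.cls_subst (V : Val Γ A) (σ : Subst Γ Δ) : (V.subst σ).cls = V.cls.subst σ.cls :=
  Val.cls_eq.2 (.symm (.trans (V.rep_cls.subst _) (V.subst_valEq fun _ x => (σ x).rep_cls)))

theorem Comp.cls_subst (M : Comp Γ C) (σ : Subst Γ Δ) : (M.subst σ).cls = M.cls.subst σ.cls :=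
  Comp.cls_eq.2 (.symm (.trans (M.rep_cls.subst _) (M.subst_compEq fun _ x => (σ x).rep_cls)))

namespace Subst

theorem cls_id (Γ : Ctx Op) : (Subst.id Γ).cls = .id Γ := rfl

theorem cls_wk (Γ : Ctx Op) (B : VTy Op) : (Subst.wk Γ B).cls = .wk Γ B := rfl

theorem cls_cons (σ : Subst Γ Δ) (V : Val Δ B) : (σ.cons V).cls = σ.cls.cons V.cls := by
  funext A x
  cases x <;> rfl

theorem cls_comp (σ : Subst Γ Δ) (τ : Subst Δ Θ) : (σ.comp τ).cls = σ.cls.comp τ.cls := by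
  funext A x
  exact Val.cls_subst _ _

theorem cls_lift (σ : Subst Γ Δ) (B : VTy Op) : (σ.lift B).cls = σ.cls.lift B := by
  funext A x
  cases x with
  | zero => rfl
  | succ x =>
    simp only [Subst.cls, Subst.lift, Val.weaken_eq_subst, Val.cls_subst, cls_wk]
    rfl

end Subst

theorem Val.cls_weaken (V : Val Γ A) (B : VTy Op) : (V.weaken B).cls = V.cls.subst (.wk Γ B) := by
  rw [Val.weaken_eq_subst, Val.cls_subst, Subst.cls_wk]

theorem Hdl.cls_weaken (H : Hdl Γ S C) (B : VTy Op) (o : {o // o ∈ S.dom}) :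
    (Hdl.weaken H B o).cls = (H o).cls.subst (((QSubst.wk Γ B).lift _).lift _) := by
  rw [Hdl.weaken_eq_subst, Comp.cls_subst, Subst.cls_lift, Subst.cls_lift, Subst.cls_wk]

theorem Comp.cls_weakenUnder (M : Comp (A :: Γ) C) (B : VTy Op) :
    (M.weakenUnder B).cls = M.cls.subst ((QSubst.wk Γ B).lift A) := by
  rw [Comp.weakenUnder_eq_subst, Comp.cls_subst, Subst.cls_lift, Subst.cls_wk]

theorem Comp.cls_inst (M : Comp (A :: Γ) C) (V : Val Γ A) :
    (M.inst V).cls = M.cls.subst ((QSubst.id Γ).cons V.cls) := by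
  rw [Comp.inst, Comp.cls_subst, Subst.cls_cons, Subst.cls_id]

theorem Comp.cls_inst₂ (M : Comp (B :: A :: Γ) C) (V : Val Γ A) (W : Val Γ B) :
    (M.inst₂ V W).cls = M.cls.subst (((QSubst.id Γ).cons V.cls).cons W.cls) := by
  rw [Comp.inst₂, Comp.cls_subst, Subst.cls_cons, Subst.cls_cons, Subst.cls_id]

theorem Comp.cls_replace (M : Comp (A :: Γ) C) (V : Val (B :: Γ) A) :
    (M.replace V).cls = M.cls.subst ((QSubst.wk Γ B).cons V.cls) := by
  rw [Comp.replace_eq_subst, Comp.cls_subst, Subst.cls_cons, Subst.cls_wk]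

namespace QVal

@[simp] theorem var_subst (x : Var Γ A) (σ : QSubst Γ Δ) : (var x).subst σ = σ A x := by
  obtain ⟨σ, rfl⟩ := σ.exists_cls
  rw [← Val.cls_var, ← Val.cls_subst, Val.subst, Subst.cls]

@[simp] theorem lam_subst (m : QComp (A :: Γ) C) (σ : QSubst Γ Δ) :
    (lam m).subst σ = lam (m.subst (σ.lift A)) := by
  obtain ⟨σ, rfl⟩ := σ.exists_cls
  obtain ⟨M, rfl⟩ := m.exists_cls
  simp only [← Val.cls_lam, ← Val.cls_subst, ← Comp.cls_subst, ← Subst.cls_lift, Val.subst]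

@[simp] theorem tuple_subst (v : ∀ i, QVal Γ (F i)) (σ : QSubst Γ Δ) :
    (tuple v).subst σ = tuple fun i => (v i).subst σ := by
  obtain ⟨σ, rfl⟩ := σ.exists_cls
  obtain ⟨V, rfl⟩ := exists_cls_tuple v
  simp only [← Val.cls_tuple, ← Val.cls_subst, Val.subst]

@[simp] theorem proj_subst (i : Fin n) (v : QVal Γ (.prod F)) (σ : QSubst Γ Δ) :
    (proj i v).subst σ = proj i (v.subst σ) := by
  obtain ⟨σ, rfl⟩ := σ.exists_cls
  obtain ⟨V, rfl⟩ := v.exists_cls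
  simp only [← Val.cls_proj, ← Val.cls_subst, Val.subst]

@[simp] theorem inl_subst (v : QVal Γ A) (σ : QSubst Γ Δ) :
    (inl (B := B) v).subst σ = inl (v.subst σ) := by
  obtain ⟨σ, rfl⟩ := σ.exists_cls
  obtain ⟨V, rfl⟩ := v.exists_cls
  simp only [← Val.cls_inl, ← Val.cls_subst, Val.subst]

@[simp] theorem inr_subst (v : QVal Γ B) (σ : QSubst Γ Δ) :
    (inr (A := A) v).subst σ = inr (v.subst σ) := by
  obtain ⟨σ, rfl⟩ := σ.exists_cls
  obtain ⟨V, rfl⟩ := v.exists_cls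
  simp only [← Val.cls_inr, ← Val.cls_subst, Val.subst]

@[simp] theorem subst_subst (v : QVal Γ A) (σ : QSubst Γ Δ) (τ : QSubst Δ Θ) :
    (v.subst σ).subst τ = v.subst (σ.comp τ) := by
  obtain ⟨σ, rfl⟩ := σ.exists_cls
  obtain ⟨τ, rfl⟩ := τ.exists_cls
  obtain ⟨V, rfl⟩ := v.exists_cls
  simp only [← Val.cls_subst, ← Subst.cls_comp, Val.subst_subst]

@[simp] theorem subst_id (v : QVal Γ A) : v.subst (.id Γ) = v := by
  obtain ⟨V, rfl⟩ := v.exists_cls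
  rw [← Subst.cls_id, ← Val.cls_subst, Val.subst_id]

end QVal

namespace QComp

@[simp] theorem app_subst (v : QVal Γ (A.fn C)) (w : QVal Γ A) (σ : QSubst Γ Δ) :
    (app v w).subst σ = app (v.subst σ) (w.subst σ) := by
  obtain ⟨σ, rfl⟩ := σ.exists_cls
  obtain ⟨V, rfl⟩ := v.exists_cls
  obtain ⟨W, rfl⟩ := w.exists_cls
  simp only [← Comp.cls_app, ← Comp.cls_subst, ← Val.cls_subst, Comp.subst]

@[simp] theorem ret_subst (v : QVal Γ A) (σ : QSubst Γ Δ) :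
    (ret (S := S) v).subst σ = ret (v.subst σ) := by
  obtain ⟨σ, rfl⟩ := σ.exists_cls
  obtain ⟨V, rfl⟩ := v.exists_cls
  simp only [← Comp.cls_ret, ← Comp.cls_subst, ← Val.cls_subst, Comp.subst]

@[simp] theorem letin_subst (m : QComp Γ ⟨A, S⟩) (n : QComp (A :: Γ) ⟨B, S⟩) (σ : QSubst Γ Δ) :
    (letin m n).subst σ = letin (m.subst σ) (n.subst (σ.lift A)) := by
  obtain ⟨σ, rfl⟩ := σ.exists_cls
  obtain ⟨M, rfl⟩ := m.exists_cls
  obtain ⟨N, rfl⟩ := n.exists_cls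
  simp only [← Comp.cls_letin, ← Comp.cls_subst, ← Subst.cls_lift, Comp.subst]

@[simp] theorem op_subst (o : {o // o ∈ S.dom}) (v : QVal Γ (S.arg o)) (σ : QSubst Γ Δ) :
    (op o v).subst σ = op o (v.subst σ) := by
  obtain ⟨σ, rfl⟩ := σ.exists_cls
  obtain ⟨V, rfl⟩ := v.exists_cls
  simp only [← Comp.cls_op, ← Comp.cls_subst, ← Val.cls_subst, Comp.subst]

@[simp] theorem handle_subst (m : QComp Γ ⟨A, S⟩) (h : QHdl Γ S C) (n : QComp (A :: Γ) C)
    (σ : QSubst Γ Δ) :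
    (handle m h n).subst σ =
      handle (m.subst σ) (fun o => (h o).subst ((σ.lift _).lift _)) (n.subst (σ.lift A)) := by
  obtain ⟨σ, rfl⟩ := σ.exists_cls
  obtain ⟨M, rfl⟩ := m.exists_cls
  obtain ⟨N, rfl⟩ := n.exists_cls
  obtain ⟨H, rfl⟩ := h.exists_cls
  simp only [← Subst.cls_lift, ← Comp.cls_subst, ← Comp.cls_handle, Comp.subst]

@[simp] theorem case_subst (v : QVal Γ (.sum A B)) (m : QComp (A :: Γ) C) (n : QComp (B :: Γ) C)
    (σ : QSubst Γ Δ) :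
    (case v m n).subst σ = case (v.subst σ) (m.subst (σ.lift A)) (n.subst (σ.lift B)) := by
  obtain ⟨σ, rfl⟩ := σ.exists_cls
  obtain ⟨V, rfl⟩ := v.exists_cls
  obtain ⟨M, rfl⟩ := m.exists_cls
  obtain ⟨N, rfl⟩ := n.exists_cls
  simp only [← Comp.cls_case, ← Comp.cls_subst, ← Val.cls_subst, ← Subst.cls_lift, Comp.subst]

@[simp] theorem subst_subst (m : QComp Γ C) (σ : QSubst Γ Δ) (τ : QSubst Δ Θ) :
    (m.subst σ).subst τ = m.subst (σ.comp τ) := by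
  obtain ⟨σ, rfl⟩ := σ.exists_cls
  obtain ⟨τ, rfl⟩ := τ.exists_cls
  obtain ⟨M, rfl⟩ := m.exists_cls
  simp only [← Comp.cls_subst, ← Subst.cls_comp, Comp.subst_subst]

@[simp] theorem subst_id (m : QComp Γ C) : m.subst (.id Γ) = m := by
  obtain ⟨M, rfl⟩ := m.exists_cls
  rw [← Subst.cls_id, ← Comp.cls_subst, Comp.subst_id]

end QComp

namespace QSubst

@[simp] theorem cons_zero (σ : QSubst Γ Δ) (v : QVal Δ B) : σ.cons v B .zero = v := rfl

@[simp] theorem cons_succ (σ : QSubst Γ Δ) (v : QVal Δ B) (x : Var Γ A) :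
    σ.cons v A (.succ x) = σ A x := rfl

@[simp] theorem id_apply (x : Var Γ A) : id Γ A x = .var x := rfl

@[simp] theorem wk_apply (x : Var Γ A) : wk Γ B A x = .var (.succ x) := rfl

@[simp] theorem comp_apply (σ : QSubst Γ Δ) (τ : QSubst Δ Θ) (x : Var Γ A) :
    σ.comp τ A x = (σ A x).subst τ := rfl

@[simp] theorem lift_eq (σ : QSubst Γ Δ) (B : VTy Op) :
    σ.lift B = (σ.comp (wk Δ B)).cons (.var .zero) := rfl

@[simp] theorem cons_comp (σ : QSubst Γ Δ) (v : QVal Δ B) (τ : QSubst Δ Θ) :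
    (σ.cons v).comp τ = (σ.comp τ).cons (v.subst τ) := by
  funext A x
  cases x <;> rfl

@[simp] theorem comp_id (σ : QSubst Γ Δ) : σ.comp (id Δ) = σ := by
  funext A x
  simp

@[simp] theorem id_comp (σ : QSubst Γ Δ) : (id Γ).comp σ = σ := by
  funext A x
  simp

@[simp] theorem wk_comp_cons (σ : QSubst Γ Δ) (v : QVal Δ B) : (wk Γ B).comp (σ.cons v) = σ := by
  funext A x
  simp

@[simp] theorem comp_assoc (σ : QSubst Γ Δ) (τ : QSubst Δ Θ) (υ : QSubst Θ Ξ) :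
    (σ.comp τ).comp υ = σ.comp (τ.comp υ) := by
  funext A x
  simp

end QSubst

namespace QVal

@[simp] theorem proj_tuple (v : ∀ i, QVal Γ (F i)) (i : Fin n) : (tuple v).proj i = v i := by
  obtain ⟨V, rfl⟩ := exists_cls_tuple v
  rw [← Val.cls_tuple, ← Val.cls_proj]
  exact Val.cls_eq.2 (.prod_beta V i)

theorem tuple_proj (v : QVal Γ (.prod F)) : (tuple fun i => v.proj i) = v := by
  obtain ⟨V, rfl⟩ := v.exists_cls
  simp only [← Val.cls_tuple, ← Val.cls_proj]
  exact Val.cls_eq.2 (.symm (.prod_eta V))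

theorem prod_ext {v w : QVal Γ (.prod F)} (h : ∀ i, v.proj i = w.proj i) : v = w := by
  rw [← v.tuple_proj, ← w.tuple_proj, funext h]

theorem lam_eta (v : QVal Γ (A.fn C)) : lam (.app (v.subst (.wk Γ A)) (.var .zero)) = v := by
  obtain ⟨V, rfl⟩ := v.exists_cls
  rw [← Val.cls_weaken, ← Val.cls_var, ← Comp.cls_app, ← Val.cls_lam]
  exact Val.cls_eq.2 (.symm (.lam_eta V))

theorem fn_ext {v w : QVal Γ (A.fn C)}
    (h : QComp.app (v.subst (.wk Γ A)) (.var .zero) = QComp.app (w.subst (.wk Γ A)) (.var .zero)) :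
    v = w := by
  rw [← v.lam_eta, ← w.lam_eta, h]

end QVal

namespace QComp

@[simp] theorem app_lam (m : QComp (A :: Γ) C) (v : QVal Γ A) :
    app (.lam m) v = m.subst ((QSubst.id Γ).cons v) := by
  obtain ⟨M, rfl⟩ := m.exists_cls
  obtain ⟨V, rfl⟩ := v.exists_cls
  rw [← Val.cls_lam, ← Comp.cls_app, ← Comp.cls_inst]
  exact Comp.cls_eq.2 (.lam_beta M V)

@[simp] theorem letin_ret (v : QVal Γ A) (m : QComp (A :: Γ) ⟨B, S⟩) :
    letin (ret v) m = m.subst ((QSubst.id Γ).cons v) := by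
  obtain ⟨V, rfl⟩ := v.exists_cls
  obtain ⟨M, rfl⟩ := m.exists_cls
  rw [← Comp.cls_ret, ← Comp.cls_letin, ← Comp.cls_inst]
  exact Comp.cls_eq.2 (.ret_let V M)

@[simp] theorem letin_ret_var (m : QComp Γ ⟨A, S⟩) : letin m (ret (.var .zero)) = m := by
  obtain ⟨M, rfl⟩ := m.exists_cls
  rw [← Val.cls_var, ← Comp.cls_ret, ← Comp.cls_letin]
  exact Comp.cls_eq.2 (.let_ret M)

@[simp] theorem letin_letin {A₁ A₂ A₃ : VTy Op} (m : QComp Γ ⟨A₁, S⟩) (n : QComp (A₁ :: Γ) ⟨A₂, S⟩)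
    (l : QComp (A₂ :: Γ) ⟨A₃, S⟩) :
    letin (letin m n) l = letin m (letin n (l.subst ((QSubst.wk Γ A₁).lift A₂))) := by
  obtain ⟨M, rfl⟩ := m.exists_cls
  obtain ⟨N, rfl⟩ := n.exists_cls
  obtain ⟨L, rfl⟩ := l.exists_cls
  simp only [← Comp.cls_weakenUnder, ← Comp.cls_letin]
  exact Comp.cls_eq.2 (.let_let M N L)

@[simp] theorem handle_ret (v : QVal Γ A) (h : QHdl Γ S C) (m : QComp (A :: Γ) C) :
    handle (ret v) h m = m.subst ((QSubst.id Γ).cons v) := by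
  obtain ⟨V, rfl⟩ := v.exists_cls
  obtain ⟨M, rfl⟩ := m.exists_cls
  obtain ⟨H, rfl⟩ := h.exists_cls
  rw [← Comp.cls_ret, ← Comp.cls_handle, ← Comp.cls_inst]
  exact Comp.cls_eq.2 (.handle_ret V H M)

@[simp] theorem handle_letin (l : QComp Γ ⟨A, S⟩) (m : QComp (A :: Γ) ⟨B, S⟩) (h : QHdl Γ S C)
    (n : QComp (B :: Γ) C) :
    handle (letin l m) h n =
      handle l h (handle m (fun o => (h o).subst (((QSubst.wk Γ A).lift _).lift _))
        (n.subst ((QSubst.wk Γ A).lift B))) := by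
  obtain ⟨L, rfl⟩ := l.exists_cls
  obtain ⟨M, rfl⟩ := m.exists_cls
  obtain ⟨H, rfl⟩ := h.exists_cls
  obtain ⟨N, rfl⟩ := n.exists_cls
  simp only [← Hdl.cls_weaken, ← Comp.cls_weakenUnder, ← Comp.cls_handle, ← Comp.cls_letin]
  exact Comp.cls_eq.2 (.handle_let L M H N)

@[simp] theorem handle_op (o : {o // o ∈ S.dom}) (v : QVal Γ (S.arg o)) (h : QHdl Γ S C)
    (m : QComp (S.res o :: Γ) C) :
    handle (op o v) h m = (h o).subst (((QSubst.id Γ).cons v).cons (.lam m)) := by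
  obtain ⟨V, rfl⟩ := v.exists_cls
  obtain ⟨M, rfl⟩ := m.exists_cls
  obtain ⟨H, rfl⟩ := h.exists_cls
  rw [← Comp.cls_op, ← Comp.cls_handle, ← Val.cls_lam, ← Comp.cls_inst₂]
  exact Comp.cls_eq.2 (.handle_op o V H M)

@[simp] theorem case_inl (v : QVal Γ A) (m : QComp (A :: Γ) C) (n : QComp (B :: Γ) C) :
    case (.inl v) m n = m.subst ((QSubst.id Γ).cons v) := by
  obtain ⟨V, rfl⟩ := v.exists_cls
  obtain ⟨M, rfl⟩ := m.exists_cls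
  obtain ⟨N, rfl⟩ := n.exists_cls
  rw [← Val.cls_inl, ← Comp.cls_case, ← Comp.cls_inst]
  exact Comp.cls_eq.2 (.case_inl V M N)

@[simp] theorem case_inr (v : QVal Γ B) (m : QComp (A :: Γ) C) (n : QComp (B :: Γ) C) :
    case (.inr v) m n = n.subst ((QSubst.id Γ).cons v) := by
  obtain ⟨V, rfl⟩ := v.exists_cls
  obtain ⟨M, rfl⟩ := m.exists_cls
  obtain ⟨N, rfl⟩ := n.exists_cls
  rw [← Val.cls_inr, ← Comp.cls_case, ← Comp.cls_inst]
  exact Comp.cls_eq.2 (.case_inr V M N)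

theorem case_eta (v : QVal Γ (.sum A B)) (m : QComp (.sum A B :: Γ) C) :
    case v (m.subst ((QSubst.wk Γ A).cons (.inl (.var .zero))))
      (m.subst ((QSubst.wk Γ B).cons (.inr (.var .zero)))) = m.subst ((QSubst.id Γ).cons v) := by
  obtain ⟨V, rfl⟩ := v.exists_cls
  obtain ⟨M, rfl⟩ := m.exists_cls
  simp only [← Val.cls_var, ← Val.cls_inl, ← Val.cls_inr, ← Comp.cls_replace, ← Comp.cls_case,
    ← Comp.cls_inst]
  exact Comp.cls_eq.2 (.case_eta V M)

end QComp

end Quotient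

section TermModel

variable {Op : Type w} {Γ Δ : Ctx Op} {A B C A' B' : VTy Op} {S : Sig Op (VTy Op)}

/-! ## Pairs and thunks of classes -/

/-- The two types of a pair. -/
def VTy.pairFam (A B : VTy Op) : Fin 2 → VTy Op
  | 0 => A
  | 1 => B

/-- The empty product type. -/
def VTy.unit : VTy Op := .prod (n := 0) Fin.elim0

/-- The binary product type. -/
def VTy.pair (A B : VTy Op) : VTy Op := .prod (A.pairFam B)

/-- The type of thunks of computations of type `A ! S`. -/
def VTy.thunk (S : Sig Op (VTy Op)) (A : VTy Op) : VTy Op := VTy.unit.fn ⟨A, S⟩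

noncomputable section

namespace QVal

/-- The class of the empty tuple. -/
def star : QVal Γ VTy.unit := tuple fun i => i.elim0

/-- Binary pairing on classes. -/
def pair (v : QVal Γ A) (w : QVal Γ B) : QVal Γ (A.pair B) :=
  tuple fun | 0 => v | 1 => w

/-- The first component of a class of pairs. -/
def fst (v : QVal Γ (A.pair B)) : QVal Γ A := proj (F := A.pairFam B) 0 v

/-- The second component of a class of pairs. -/
def snd (v : QVal Γ (A.pair B)) : QVal Γ B := proj (F := A.pairFam B) 1 v

/-- The computation run by a thunk. -/
def force (v : QVal Γ (A.thunk S)) : QComp Γ ⟨A, S⟩ := .app v star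

end QVal

/-- The thunk of a computation. -/
def QComp.thunk (m : QComp Γ ⟨A, S⟩) : QVal Γ (A.thunk S) := .lam (m.subst (.wk Γ _))

namespace QVal

theorem eq_star (v : QVal Γ VTy.unit) : v = star := prod_ext fun i => i.elim0

@[simp] theorem star_subst (σ : QSubst Γ Δ) : star.subst σ = star := eq_star _

@[simp] theorem fst_pair (v : QVal Γ A) (w : QVal Γ B) : (pair v w).fst = v :=
  proj_tuple (F := A.pairFam B) _ 0

@[simp] theorem snd_pair (v : QVal Γ A) (w : QVal Γ B) : (pair v w).snd = w :=
  proj_tuple (F := A.pairFam B) _ 1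

theorem pair_ext {v w : QVal Γ (A.pair B)} (hfst : v.fst = w.fst) (hsnd : v.snd = w.snd) : v = w :=
  prod_ext fun | 0 => hfst | 1 => hsnd

@[simp] theorem pair_fst_snd (v : QVal Γ (A.pair B)) : pair v.fst v.snd = v :=
  pair_ext (fst_pair _ _) (snd_pair _ _)

@[simp] theorem fst_subst (v : QVal Γ (A.pair B)) (σ : QSubst Γ Δ) :
    v.fst.subst σ = (v.subst σ).fst := proj_subst (F := A.pairFam B) _ _ _

@[simp] theorem snd_subst (v : QVal Γ (A.pair B)) (σ : QSubst Γ Δ) :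
    v.snd.subst σ = (v.subst σ).snd := proj_subst (F := A.pairFam B) _ _ _

@[simp] theorem pair_subst (v : QVal Γ A) (w : QVal Γ B) (σ : QSubst Γ Δ) :
    (pair v w).subst σ = pair (v.subst σ) (w.subst σ) :=
  pair_ext (by rw [← fst_subst, fst_pair, fst_pair]) (by rw [← snd_subst, snd_pair, snd_pair])

@[simp] theorem force_thunk (m : QComp Γ ⟨A, S⟩) : m.thunk.force = m := by
  simp [force, QComp.thunk]

@[simp] theorem force_subst (v : QVal Γ (A.thunk S)) (σ : QSubst Γ Δ) :
    v.force.subst σ = (v.subst σ).force :=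
  (QComp.app_subst _ _ _).trans (by rw [star_subst]; rfl)

@[simp] theorem thunk_force (v : QVal Γ (A.thunk S)) : v.force.thunk = v := by
  refine .trans (congrArg lam ?_) v.lam_eta
  rw [force_subst, eq_star (var .zero)]
  rfl

theorem force_ext {v w : QVal Γ (A.thunk S)} (h : v.force = w.force) : v = w := by
  rw [← v.thunk_force, ← w.thunk_force, h]

@[simp] theorem thunk_subst (m : QComp Γ ⟨A, S⟩) (σ : QSubst Γ Δ) :
    m.thunk.subst σ = (m.subst σ).thunk :=
  force_ext (by rw [← force_subst, force_thunk, force_thunk])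

end QVal

/-! ## The category of types and terms -/

/-- Morphisms of the term model: maps from classes of values of type `A` to classes of values of
type `B`, in every context, compatible with substitution. By the Yoneda lemma these are the classes
of values of type `B` with one free variable of type `A`; in this form composition is strict. -/
@[ext]
structure TermHom (A B : VTy Op) : Type w where
  app : ∀ {Γ : Ctx Op}, QVal Γ A → QVal Γ B
  app_subst : ∀ {Γ Δ : Ctx Op} (v : QVal Γ A) (σ : QSubst Γ Δ), (app v).subst σ = app (v.subst σ)

instance : Category.{w} (VTy Op) where
  Hom := TermHom
  id A := ⟨fun v => v, fun _ _ => rfl⟩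
  comp f g := ⟨fun v => g.app (f.app v), fun _ _ => by rw [g.app_subst, f.app_subst]⟩

namespace TermHom

attribute [simp] app_subst

theorem hom_ext {f g : A ⟶ B} (h : ∀ (Γ : Ctx Op) (v : QVal Γ A), f.app v = g.app v) : f = g :=
  TermHom.ext (funext fun Γ => funext (h Γ))

@[simp] theorem id_app (v : QVal Γ A) : TermHom.app (𝟙 A) v = v := rfl

@[simp] theorem comp_app (f : A ⟶ B) (g : B ⟶ C) (v : QVal Γ A) :
    TermHom.app (f ≫ g) v = g.app (f.app v) := rfl

/-- The empty product type is terminal. -/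
abbrev unitLimit (Op : Type w) : LimitCone (Functor.empty.{0} (VTy Op)) where
  cone := asEmptyCone VTy.unit
  isLimit := IsTerminal.ofUniqueHom (fun _ => ⟨fun _ => .star, fun _ σ => QVal.star_subst σ⟩)
    fun _ _ => hom_ext fun _ _ => QVal.eq_star _

/-- Pair types are binary products. -/
abbrev pairLimit (A B : VTy Op) : LimitCone (Limits.pair A B) where
  cone := BinaryFan.mk (P := A.pair B) ⟨.fst, QVal.fst_subst⟩ ⟨.snd, QVal.snd_subst⟩
  isLimit := BinaryFan.IsLimit.mk _
    (fun f g => ⟨fun v => (f.app v).pair (g.app v), fun _ _ => by simp⟩)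
    (fun f g => hom_ext fun _ v => QVal.fst_pair (f.app v) (g.app v))
    (fun f g => hom_ext fun _ v => QVal.snd_pair (f.app v) (g.app v))
    (by
      rintro Z _ _ h rfl rfl
      exact hom_ext fun _ v => (QVal.pair_fst_snd (h.app v)).symm)

instance : CartesianMonoidalCategory (VTy Op) := .ofChosenFiniteProducts (unitLimit Op) pairLimit

@[simp] theorem tensorHom_app (f : A ⟶ A') (g : B ⟶ B') (v : QVal Γ (A ⊗ B)) :
    TermHom.app (f ⊗ₘ g) v = (f.app v.fst).pair (g.app v.snd) := rfl

@[simp] theorem whiskerLeft_app (A : VTy Op) (f : B ⟶ C) (v : QVal Γ (A ⊗ B)) :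
    TermHom.app (A ◁ f) v = v.fst.pair (f.app v.snd) := rfl

@[simp] theorem whiskerRight_app (f : A ⟶ B) (C : VTy Op) (v : QVal Γ (A ⊗ C)) :
    TermHom.app (f ▷ C) v = (f.app v.fst).pair v.snd := rfl

@[simp] theorem associator_hom_app (v : QVal Γ ((A ⊗ B) ⊗ C)) :
    TermHom.app (α_ A B C).hom v = v.fst.fst.pair (v.fst.snd.pair v.snd) := rfl

@[simp] theorem associator_inv_app (v : QVal Γ (A ⊗ B ⊗ C)) :
    TermHom.app (α_ A B C).inv v = (v.fst.pair v.snd.fst).pair v.snd.snd := rfl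

@[simp] theorem leftUnitor_hom_app (v : QVal Γ (𝟙_ _ ⊗ A)) :
    TermHom.app (λ_ A).hom v = v.snd := rfl

@[simp] theorem tensorObj_eq (A B : VTy Op) : A ⊗ B = A.pair B := rfl

/-! ## The strong monads of thunks -/

/-- The strong monad `T_S`, sending `A` to the type of thunks of computations of type `A ! S`. -/
def strongMonad (S : Sig Op (VTy Op)) : StrongMonad (VTy Op) where
  obj A := A.thunk S
  map f := ⟨fun v => (v.force.letin (.ret (f.app (.var .zero)))).thunk, by simp⟩
  map_id _ := hom_ext fun _ v => QVal.force_ext (by simp)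
  map_comp _ _ := hom_ext fun _ v => QVal.force_ext (by simp)
  η :=
    { app _ := ⟨fun v => (QComp.ret v).thunk, by simp⟩
      naturality _ _ _ := hom_ext fun _ v => QVal.force_ext (by simp) }
  μ :=
    { app _ := ⟨fun v => (v.force.letin (QVal.var .zero).force).thunk, by simp⟩
      naturality _ _ _ := hom_ext fun _ v => QVal.force_ext (by simp) }
  assoc _ := hom_ext fun _ v => QVal.force_ext (by simp)
  left_unit _ := hom_ext fun _ v => QVal.force_ext (by simp)
  right_unit _ := hom_ext fun _ v => QVal.force_ext (by simp)
  st A B :=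
    ⟨fun {Γ} v => (v.snd.force.letin
      (.ret ((v.fst.subst (.wk Γ B)).pair (.var .zero)))).thunk, by simp⟩
  st_natural _ _ := hom_ext fun _ v => QVal.force_ext (by simp)
  st_leftUnitor _ := hom_ext fun _ v => QVal.force_ext (by simp)
  st_associator _ _ _ := hom_ext fun _ v => QVal.force_ext (by simp)
  st_unit _ _ := hom_ext fun _ v => QVal.force_ext (by simp)
  st_mult _ _ := hom_ext fun _ v => QVal.force_ext (by simp)

end TermHom

end

end TermModel

theorem isDistribKleisliCoprod_of_whiskerLeft {C : Type u} [Category.{v} C]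
    [CartesianMonoidalCategory C] {T : StrongMonad C} {X₁ X₂ P : C} {i₁ : X₁ ⟶ P} {i₂ : X₂ ⟶ P}
    (h : ∀ Z : C, IsKleisliCoprod T (Z ◁ i₁) (Z ◁ i₂)) : IsDistribKleisliCoprod T i₁ i₂ := by
  refine ⟨fun Y f₁ f₂ => ?_, h⟩
  refine ((λ_ P).symm.homFromEquiv.existsUnique_congr fun g => ?_).mpr
    (h (𝟙_ C) Y ((λ_ X₁).hom ≫ f₁) ((λ_ X₂).hom ≫ f₂))
  simp

noncomputable section

variable {Op : Type w} {Γ Δ : Ctx Op} {A B X Y Z : VTy Op} {S S' : Sig Op (VTy Op)}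

namespace TermHom

@[simp] theorem strongMonad_obj : (strongMonad S).obj A = A.thunk S := rfl

@[simp] theorem map_app (f : A ⟶ B) (v : QVal Γ (A.thunk S)) :
    TermHom.app ((strongMonad S).map f) v =
      (v.force.letin (.ret (f.app (.var .zero)))).thunk := rfl

@[simp] theorem unit_app (v : QVal Γ A) :
    TermHom.app ((strongMonad S).η.app A) v = (QComp.ret v).thunk := rfl

@[simp] theorem mult_app (v : QVal Γ ((A.thunk S).thunk S)) :
    TermHom.app ((strongMonad S).μ.app A) v =
      (v.force.letin (QVal.var .zero).force).thunk := rfl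

@[simp] theorem strength_app (v : QVal Γ (A ⊗ B.thunk S)) :
    TermHom.app ((strongMonad S).st A B) v =
      (v.snd.force.letin (.ret ((v.fst.subst (.wk Γ B)).pair (.var .zero)))).thunk := rfl

/-! ## The term model -/

/-- Tuple types are finite products. -/
def tupleLimit {n : ℕ} (F : Fin n → VTy Op) : LimitCone (Discrete.functor F) where
  cone := Fan.mk (VTy.prod F) fun i => ⟨.proj i, QVal.proj_subst i⟩
  isLimit := Fan.IsLimit.mk _ (fun s => ⟨fun v => .tuple fun i => (s.proj i).app v, by simp⟩)
    (fun s i => hom_ext fun _ v => QVal.proj_tuple (fun i => (s.proj i).app v) i)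
    (fun s _ h => hom_ext fun _ v => QVal.prod_ext fun i =>
      (congrArg (TermHom.app · v) (h i)).trans (QVal.proj_tuple (fun i => (s.proj i).app v) i).symm)

/-- Products of families indexed by a finite set of operation symbols: tuple types, along an
enumeration of the index set. -/
def opLimit (d : Finset Op) (F : {o // o ∈ d} → VTy Op) : LimitCone (Discrete.functor F) :=
  let reindex := Cone.equivalenceOfReindexing (Discrete.equivalence d.equivFin)
    (F := Discrete.functor fun i => F (d.equivFin.symm i)) (G := Discrete.functor F)
    (Discrete.natIso fun o => eqToIso (congrArg F (d.equivFin.symm_apply_apply o.as)))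
  ⟨reindex.functor.obj (tupleLimit _).cone,
    (IsLimit.ofConeEquiv reindex).symm (tupleLimit _).isLimit⟩

/-- Currying for function types. -/
def curryEquiv (X Y Z : VTy Op) (S : Sig Op (VTy Op)) :
    (X.pair Y ⟶ Z.thunk S) ≃ (X ⟶ Y.fn ⟨Z, S⟩) where
  toFun g := ⟨fun {Γ} v => .lam (g.app ((v.subst (.wk Γ Y)).pair (.var .zero))).force, by simp⟩
  invFun h := ⟨fun v => (QComp.app (h.app v.fst) v.snd).thunk, by simp⟩
  left_inv g := hom_ext fun _ v => QVal.force_ext (by simp)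
  right_inv h := hom_ext fun _ v => QVal.fn_ext (by simp)

@[simp] theorem curryEquiv_app (g : X.pair Y ⟶ Z.thunk S) (v : QVal Γ X) :
    (curryEquiv X Y Z S g).app v =
      .lam (g.app ((v.subst (.wk Γ Y)).pair (.var .zero))).force := rfl

theorem curryEquiv_natural {X X' : VTy Op} (f : X' ⟶ X) (g : X.pair Y ⟶ Z.thunk S) :
    curryEquiv X' Y Z S ((f ▷ Y : X'.pair Y ⟶ X.pair Y) ≫ g) = f ≫ curryEquiv X Y Z S g :=
  hom_ext fun Γ v => by simp

/-- Function types are Kleisli exponentials. -/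
def kleisliExp (S : Sig Op (VTy Op)) (Y Z : VTy Op) : KleisliExp (strongMonad S) Y Z where
  pt := Y.fn ⟨Z, S⟩
  curry := curryEquiv _ Y Z S
  curry_natural f g := curryEquiv_natural f g

/-- The evaluation morphism of function types. -/
def eval (Y Z : VTy Op) (S : Sig Op (VTy Op)) : (Y.fn ⟨Z, S⟩).pair Y ⟶ Z.thunk S :=
  (curryEquiv _ Y Z S).symm (𝟙 _)

@[simp] theorem eval_app (v : QVal Γ ((Y.fn ⟨Z, S⟩).pair Y)) :
    (eval Y Z S).app v = (QComp.app v.fst v.snd).thunk := rfl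

/-- The data of the term model apart from the handling morphisms and the sums. -/
def frame (Op : Type w) : EffFrame Op (VTy Op) where
  tup := tupleLimit
  opProd := opLimit
  T := strongMonad
  kexp := kleisliExp
  op S o := ⟨fun v => (QComp.op o v).thunk, by simp⟩

/-- The type of clauses for an operation. -/
abbrev clauseTy (S S' : Sig Op (VTy Op)) (X : VTy Op) (o : {o // o ∈ S.dom}) : VTy Op :=
  ((S.arg o).pair ((S.res o).fn ⟨X, S'⟩)).fn ⟨X, S'⟩

/-- The type of handlers, a product of types of clauses. -/
def hdlTy (S S' : Sig Op (VTy Op)) (X : VTy Op) : VTy Op :=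
  (opLimit S.dom (clauseTy S S' X)).cone.pt

/-- The projection from the object of handlers to the type of clauses for an operation. -/
def clauseProj (S S' : Sig Op (VTy Op)) (X : VTy Op) (o : {o // o ∈ S.dom}) :
    hdlTy S S' X ⟶ clauseTy S S' X o :=
  (opLimit S.dom (clauseTy S S' X)).cone.π.app ⟨o⟩

/-- The clauses of the handler given by a tuple of functions. -/
def clauses (h : QVal Γ (hdlTy S S' X)) : QHdl Γ S ⟨X, S'⟩ :=
  fun o => .app ((clauseProj S S' X o).app (h.subst ((QSubst.wk _ _).comp (.wk _ _))))
    ((QVal.var (.succ .zero)).pair (.var .zero))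

@[simp] theorem clauses_subst (h : QVal Γ (hdlTy S S' X)) (σ : QSubst Γ Δ)
    (o : {o // o ∈ S.dom}) :
    (clauses h o).subst (((σ.comp ((QSubst.wk Δ (S.arg o)).comp
      (.wk _ ((S.res o).fn ⟨X, S'⟩)))).cons (.var (.succ .zero))).cons (.var .zero)) =
      clauses (h.subst σ) o := by
  simp [clauses]

/-- The handling morphism of the term model. -/
def handle (S S' : Sig Op (VTy Op)) (X : VTy Op) :
    (hdlTy S S' X).pair ((X.thunk S').thunk S) ⟶ X.thunk S' :=
  ⟨fun v => (QComp.handle v.snd.force (clauses v.fst) (QVal.var .zero).force).thunk, by simp⟩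

@[simp] theorem handle_app (v : QVal Γ ((hdlTy S S' X).pair ((X.thunk S').thunk S))) :
    (handle S S' X).app v =
      (QComp.handle v.snd.force (clauses v.fst) (QVal.var .zero).force).thunk := rfl

theorem handle_app_unit (h : QVal Γ (hdlTy S S' X)) (v : QVal Γ (X.thunk S')) :
    (handle S S' X).app (h.pair (TermHom.app ((strongMonad S).η.app (X.thunk S')) v)) = v :=
  QVal.force_ext (by simp)

theorem handle_app_mult (v : QVal Γ ((hdlTy S S' X).pair (((X.thunk S').thunk S).thunk S))) :
    let w := v.fst.pair
      (TermHom.app ((strongMonad S).st (hdlTy S S' X) ((X.thunk S').thunk S)) v)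
    (handle S S' X).app (v.fst.pair (TermHom.app ((strongMonad S).μ.app (X.thunk S')) v.snd)) =
      (handle S S' X).app
        (w.fst.pair (TermHom.app ((strongMonad S).map (handle S S' X)) w.snd)) :=
  QVal.force_ext (by simp [clauses])

theorem handle_app_op (o : {o // o ∈ S.dom})
    (v : QVal Γ ((hdlTy S S' X).pair ((S.arg o).pair ((S.res o).fn ⟨X, S'⟩)))) :
    let w := (QComp.op o v.snd.fst).thunk.pair v.snd.snd
    (handle S S' X).app (v.fst.pair (TermHom.app ((strongMonad S).map (eval (S.res o) X S'))
      (TermHom.app ((strongMonad S).st ((S.res o).fn ⟨X, S'⟩) (S.res o)) (w.snd.pair w.fst)))) =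
      (eval ((S.arg o).pair ((S.res o).fn ⟨X, S'⟩)) X S').app
        (((clauseProj S S' X o).app v.fst).pair v.snd) :=
  QVal.force_ext (by
    have lam_eta := QVal.lam_eta v.snd.snd
    simp only [QVal.snd_subst] at lam_eta
    simp [clauses, lam_eta])

/-- The term model without sums. -/
def model (Op : Type w) : EffModel Op (VTy Op) where
  toEffFrame := frame Op
  handle := handle
  handle_unit _ _ _ := hom_ext fun _ v => handle_app_unit v.fst v.snd
  handle_mult _ _ _ := hom_ext fun _ v => handle_app_mult v
  handle_op _ _ _ o := hom_ext fun _ v => handle_app_op o v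

/-- Case distinction in the presence of a parameter. -/
def caseHom (f : Z.pair A ⟶ X.thunk S) (g : Z.pair B ⟶ X.thunk S) :
    Z.pair (A.sum B) ⟶ X.thunk S :=
  ⟨fun {Γ} v => (QComp.case v.snd
    (f.app ((v.fst.subst (.wk Γ A)).pair (.var .zero))).force
    (g.app ((v.fst.subst (.wk Γ B)).pair (.var .zero))).force).thunk, by simp⟩

@[simp] theorem caseHom_app (f : Z.pair A ⟶ X.thunk S) (g : Z.pair B ⟶ X.thunk S)
    (v : QVal Γ (Z.pair (A.sum B))) :
    (caseHom f g).app v = (QComp.case v.snd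
      (f.app ((v.fst.subst (.wk Γ A)).pair (.var .zero))).force
      (g.app ((v.fst.subst (.wk Γ B)).pair (.var .zero))).force).thunk := rfl

theorem caseHom_app_inl (f : Z.pair A ⟶ X.thunk S) (g : Z.pair B ⟶ X.thunk S)
    (v : QVal Γ (Z.pair A)) : (caseHom f g).app (v.fst.pair v.snd.inl) = f.app v :=
  QVal.force_ext (by simp)

theorem caseHom_app_inr (f : Z.pair A ⟶ X.thunk S) (g : Z.pair B ⟶ X.thunk S)
    (v : QVal Γ (Z.pair B)) : (caseHom f g).app (v.fst.pair v.snd.inr) = g.app v :=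
  QVal.force_ext (by simp)

theorem caseHom_unique {f : Z.pair A ⟶ X.thunk S} {g : Z.pair B ⟶ X.thunk S}
    {h : Z.pair (A.sum B) ⟶ X.thunk S}
    (hinl : ∀ {Γ : Ctx Op} (v : QVal Γ (Z.pair A)), h.app (v.fst.pair v.snd.inl) = f.app v)
    (hinr : ∀ {Γ : Ctx Op} (v : QVal Γ (Z.pair B)), h.app (v.fst.pair v.snd.inr) = g.app v) :
    h = caseHom f g :=
  hom_ext fun Γ v => QVal.force_ext (by
    have case_eta := QComp.case_eta v.snd
      (h.app ((v.fst.subst (.wk Γ (A.sum B))).pair (.var .zero))).force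
    simp only [QVal.fst_subst, QVal.force_subst, app_subst, QVal.pair_subst, QVal.subst_subst,
      QSubst.wk_comp_cons, QVal.var_subst, QSubst.cons_zero, QVal.subst_id,
      QVal.pair_fst_snd] at case_eta
    simp [case_eta, ← hinl, ← hinr])

/-- The first injection. -/
def inl (A B : VTy Op) : A ⟶ A.sum B := ⟨.inl, QVal.inl_subst⟩

/-- The second injection. -/
def inr (A B : VTy Op) : B ⟶ A.sum B := ⟨.inr, QVal.inr_subst⟩

theorem isKleisliCoprod_whiskerLeft (S : Sig Op (VTy Op)) (Z A B : VTy Op) :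
    IsKleisliCoprod (strongMonad S) (Z ◁ inl A B) (Z ◁ inr A B) := fun _ f g =>
  ⟨caseHom f g,
    ⟨hom_ext fun _ v => caseHom_app_inl f g v, hom_ext fun _ v => caseHom_app_inr f g v⟩,
    fun _ ⟨hinl, hinr⟩ => caseHom_unique (fun v => congrArg (TermHom.app · v) hinl)
      fun v => congrArg (TermHom.app · v) hinr⟩

/-- The term model. -/
def plusModel (Op : Type w) : EffPlusModel Op (VTy Op) where
  toEffModel := model Op
  sum := .sum
  inl := inl
  inr := inr
  isDistribKleisliCoprod S A B :=
    isDistribKleisliCoprod_of_whiskerLeft fun Z => isKleisliCoprod_whiskerLeft S Z A B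

theorem plusModel_copair (f : Z.pair A ⟶ X.thunk S) (g : Z.pair B ⟶ X.thunk S) :
    (plusModel Op).copair S f g = caseHom f g :=
  have ⟨hinl, hinr⟩ := (isKleisliCoprod_whiskerLeft S Z A B X f g).choose_spec.1
  caseHom_unique (fun v => congrArg (TermHom.app · v) hinl) fun v => congrArg (TermHom.app · v) hinr

end TermHom

end

noncomputable section

section HCongr

variable {Op : Type w} {Γ Γ' : Ctx Op} {A A' B B' : VTy Op} {C C' : CTy Op}
  {S S' : Sig Op (VTy Op)} {n : ℕ} {F F' : Fin n → VTy Op}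

namespace QVal

theorem var_zero_heq (hΓ : Γ' = Γ) (hA : A' = A) :
    (var .zero : QVal (A' :: Γ') A') ≍ (var .zero : QVal (A :: Γ) A) := by
  subst hΓ hA; rfl

theorem subst_wk_heq (hΓ : Γ' = Γ) (hA : A' = A) (hB : B' = B) {v' : QVal Γ' B'} {v : QVal Γ B}
    (hv : v' ≍ v) : v'.subst (.wk Γ' A') ≍ v.subst (.wk Γ A) := by
  subst hΓ hA hB hv; rfl

theorem lam_heq (hΓ : Γ' = Γ) (hA : A' = A) (hC : C' = C) {m' : QComp (A' :: Γ') C'}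
    {m : QComp (A :: Γ) C} (hm : m' ≍ m) : lam m' ≍ lam m := by
  subst hΓ hA hC hm; rfl

theorem tuple_heq (hΓ : Γ' = Γ) (hF : F' = F) {v' : ∀ i, QVal Γ' (F' i)} {v : ∀ i, QVal Γ (F i)}
    (hv : ∀ i, v' i ≍ v i) : tuple v' ≍ tuple v := by
  subst hΓ hF; rw [funext fun i => eq_of_heq (hv i)]

theorem proj_heq (hΓ : Γ' = Γ) (hF : F' = F) (i : Fin n) {v' : QVal Γ' (.prod F')}
    {v : QVal Γ (.prod F)} (hv : v' ≍ v) : v'.proj i ≍ v.proj i := by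
  subst hΓ hF hv; rfl

theorem inl_heq (hΓ : Γ' = Γ) (hA : A' = A) (hB : B' = B) {v' : QVal Γ' A'} {v : QVal Γ A}
    (hv : v' ≍ v) : inl (B := B') v' ≍ inl (B := B) v := by
  subst hΓ hA hB hv; rfl

theorem inr_heq (hΓ : Γ' = Γ) (hA : A' = A) (hB : B' = B) {v' : QVal Γ' B'} {v : QVal Γ B}
    (hv : v' ≍ v) : inr (A := A') v' ≍ inr (A := A) v := by
  subst hΓ hA hB hv; rfl

end QVal

namespace QComp

theorem app_heq (hΓ : Γ' = Γ) (hA : A' = A) (hC : C' = C) {v' : QVal Γ' (A'.fn C')}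
    {v : QVal Γ (A.fn C)} {w' : QVal Γ' A'} {w : QVal Γ A} (hv : v' ≍ v) (hw : w' ≍ w) :
    app v' w' ≍ app v w := by
  subst hΓ hA hC hv hw; rfl

theorem ret_heq (hΓ : Γ' = Γ) (hA : A' = A) (hS : S' = S) {v' : QVal Γ' A'} {v : QVal Γ A}
    (hv : v' ≍ v) : ret (S := S') v' ≍ ret (S := S) v := by
  subst hΓ hA hS hv; rfl

theorem letin_heq (hΓ : Γ' = Γ) (hA : A' = A) (hB : B' = B) (hS : S' = S)
    {m' : QComp Γ' ⟨A', S'⟩} {m : QComp Γ ⟨A, S⟩} {n' : QComp (A' :: Γ') ⟨B', S'⟩}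
    {n : QComp (A :: Γ) ⟨B, S⟩} (hm : m' ≍ m) (hn : n' ≍ n) : letin m' n' ≍ letin m n := by
  subst hΓ hA hB hS hm hn; rfl

theorem op_heq (hΓ : Γ' = Γ) (hS : S' = S) {o' : {o // o ∈ S'.dom}} {o : {o // o ∈ S.dom}}
    (ho : o'.1 = o.1) {v' : QVal Γ' (S'.arg o')} {v : QVal Γ (S.arg o)} (hv : v' ≍ v) :
    op o' v' ≍ op o v := by
  subst hΓ hS; obtain rfl := Subtype.ext ho; subst hv; rfl

theorem handle_heq (hΓ : Γ' = Γ) (hA : A' = A) (hS : S' = S) (hC : C' = C)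
    {m' : QComp Γ' ⟨A', S'⟩} {m : QComp Γ ⟨A, S⟩} {h' : QHdl Γ' S' C'} {h : QHdl Γ S C}
    {n' : QComp (A' :: Γ') C'} {n : QComp (A :: Γ) C} (hm : m' ≍ m)
    (hh : ∀ o' o, o'.1 = o.1 → h' o' ≍ h o) (hn : n' ≍ n) : handle m' h' n' ≍ handle m h n := by
  subst hΓ hA hS hC hm hn; rw [funext fun o => eq_of_heq (hh o o rfl)]

theorem case_heq (hΓ : Γ' = Γ) (hA : A' = A) (hB : B' = B) (hC : C' = C)
    {v' : QVal Γ' (A'.sum B')} {v : QVal Γ (A.sum B)} {m' : QComp (A' :: Γ') C'}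
    {m : QComp (A :: Γ) C} {n' : QComp (B' :: Γ') C'} {n : QComp (B :: Γ) C} (hv : v' ≍ v)
    (hm : m' ≍ m) (hn : n' ≍ n) : case v' m' n' ≍ case v m n := by
  subst hΓ hA hB hC hv hm hn; rfl

end QComp

end HCongr

namespace TermHom

variable {Op : Type w} {Γ Δ Δ' : Ctx Op} {A B X Z : VTy Op} {C : CTy Op}
  {S S' : Sig Op (VTy Op)} {n : ℕ} {F : Fin n → VTy Op}

/-! ## Interpretation in the term model -/

/-- The interpretation of value types in the term model. It is the identity, but not
definitionally. -/
abbrev ty (A : VTy Op) : VTy Op := (plusModel Op).ty A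

/-- The computation type whose type of thunks interprets `C` in the term model. -/
abbrev cty (C : CTy Op) : CTy Op := ⟨ty C.val, C.sig.map ty⟩

theorem ty_eq : ∀ A : VTy Op, ty A = A
  | .arrow A d a r B => by
    change VTy.arrow (ty A) d (fun o => ty (a o)) (fun o => ty (r o)) (ty B) = _
    simp only [ty_eq A, ty_eq B, fun o => ty_eq (a o), fun o => ty_eq (r o)]
  | .prod A => by
    change VTy.prod (fun i => ty (A i)) = _
    simp only [fun i => ty_eq (A i)]
  | .sum A B => by
    change VTy.sum (ty A) (ty B) = _
    simp only [ty_eq A, ty_eq B]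

theorem sig_map_ty (S : Sig Op (VTy Op)) : S.map ty = S := by
  simp only [Sig.map, ty_eq]

theorem cty_eq (C : CTy Op) : cty C = C := by
  simp only [cty, ty_eq, sig_map_ty]

/-- The action of the interpretation of a value term on classes of tuples. -/
def evalVal (V : Val Γ A) (v : QVal Δ ((plusModel Op).ctx Γ)) : QVal Δ (ty A) :=
  TermHom.app ((plusModel Op).val V) v

/-- The action of the interpretation of a computation term on classes of tuples. -/
def evalComp (M : Comp Γ C) (v : QVal Δ ((plusModel Op).ctx Γ)) : QComp Δ (cty C) :=
  QVal.force (A := ty C.val) (S := C.sig.map ty) (TermHom.app ((plusModel Op).comp M) v)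

/-- A tuple in the interpretation of `Γ`, extended by a fresh variable. -/
def extend (A : VTy Op) (v : QVal Δ ((plusModel Op).ctx Γ)) :
    QVal (ty A :: Δ) ((plusModel Op).ctx (A :: Γ)) :=
  QVal.pair (v.subst (.wk Δ (ty A))) (.var .zero)

variable (v : QVal Δ ((plusModel Op).ctx Γ))

theorem force_eval (f : QVal Γ (A.fn ⟨B, S⟩)) (v : QVal Γ A) :
    ((eval A B S).app (f.pair v)).force = .app f v := by
  simp

theorem force_bind (v : QVal Γ Z) (m : QVal Γ (A.thunk S)) (g : Z.pair A ⟶ B.thunk S) :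
    (TermHom.app ((strongMonad S).μ.app B) (TermHom.app ((strongMonad S).map g)
      (TermHom.app ((strongMonad S).st Z A) (v.pair m)))).force =
      .letin m.force (g.app ((v.subst (.wk Γ A)).pair (.var .zero))).force := by
  simp

theorem force_handle (v : QVal Γ Z) (h : QVal Γ (hdlTy S S' B)) (m : QVal Γ (A.thunk S))
    (g : Z.pair A ⟶ B.thunk S') :
    ((handle S S' B).app (h.pair (TermHom.app ((strongMonad S).map g)
      (TermHom.app ((strongMonad S).st Z A) (v.pair m))))).force =
      .handle m.force (clauses h) (g.app ((v.subst (.wk Γ A)).pair (.var .zero))).force := by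
  simp

theorem force_copair (v : QVal Γ Z) (w : QVal Γ (A.sum B)) (f : Z.pair A ⟶ X.thunk S)
    (g : Z.pair B ⟶ X.thunk S) :
    (TermHom.app ((plusModel Op).copair S f g) (v.pair w)).force =
      .case w (f.app ((v.subst (.wk Γ A)).pair (.var .zero))).force
        (g.app ((v.subst (.wk Γ B)).pair (.var .zero))).force := by
  have force_caseHom : ((caseHom f g).app (v.pair w)).force =
      .case w (f.app ((v.subst (.wk Γ A)).pair (.var .zero))).force
        (g.app ((v.subst (.wk Γ B)).pair (.var .zero))).force := by simp
  rw [← force_caseHom, ← plusModel_copair]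
  rfl

/-- Tupling into the type of handlers. -/
def hdlTuple (f : ∀ o, Z ⟶ clauseTy S S' X o) : Z ⟶ hdlTy S S' X :=
  Fan.IsLimit.lift (opLimit S.dom (clauseTy S S' X)).isLimit f

@[simp] theorem clauseProj_hdlTuple (f : ∀ o, Z ⟶ clauseTy S S' X o) (v : QVal Γ Z)
    (o : {o // o ∈ S.dom}) : (clauseProj S S' X o).app ((hdlTuple f).app v) = (f o).app v :=
  congrArg (TermHom.app · v) (Fan.IsLimit.fac (opLimit S.dom (clauseTy S S' X)).isLimit f o)

theorem clauses_hdlTuple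
    (f : ∀ o, (Z.pair (S.arg o)).pair ((S.res o).fn ⟨X, S'⟩) ⟶ X.thunk S') (v : QVal Γ Z) :
    clauses (TermHom.app (hdlTuple fun o => curryEquiv Z ((S.arg o).pair ((S.res o).fn ⟨X, S'⟩))
      X S' ((α_ _ _ _).inv ≫ f o)) v) =
      fun o => ((f o).app ((((v.subst (.wk Γ (S.arg o))).pair (.var .zero)).subst
        (.wk _ ((S.res o).fn ⟨X, S'⟩))).pair (.var .zero))).force := by
  funext o
  simp [clauses]

theorem evalVal_lam (M : Comp (A :: Γ) C) :
    evalVal (.lam M) v = QVal.lam (C := cty C) (evalComp M (extend A v)) := by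
  rw [evalVal, EffPlusModel.val]; rfl

theorem evalVal_tuple (V : ∀ i, Val Γ (F i)) :
    evalVal (.tuple V) v = QVal.tuple (F := fun i => ty (F i)) fun i => evalVal (V i) v := by
  rw [evalVal, EffPlusModel.val]; rfl

theorem evalVal_proj (V : Val Γ (.prod F)) (i : Fin n) :
    evalVal (.proj i V) v = QVal.proj (F := fun i => ty (F i)) i (evalVal V v) := by
  rw [evalVal, EffPlusModel.val]; rfl

theorem evalVal_inl (V : Val Γ A) :
    evalVal (.inl (B := B) V) v = QVal.inl (B := ty B) (evalVal V v) := by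
  rw [evalVal, EffPlusModel.val]; rfl

theorem evalVal_inr (V : Val Γ B) :
    evalVal (.inr (A := A) V) v = QVal.inr (A := ty A) (evalVal V v) := by
  rw [evalVal, EffPlusModel.val]; rfl

theorem evalComp_app (V : Val Γ (A.fn C)) (W : Val Γ A) :
    evalComp (.app V W) v = QComp.app (A := ty A) (evalVal V v) (evalVal W v) := by
  rw [evalComp, EffPlusModel.comp]
  exact force_eval _ _

theorem evalComp_ret (V : Val Γ A) :
    evalComp (.ret (S := S) V) v = QComp.ret (evalVal V v) := by
  rw [evalComp, EffPlusModel.comp]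
  exact QVal.force_thunk _

theorem evalComp_letin (M : Comp Γ ⟨A, S⟩) (N : Comp (A :: Γ) ⟨B, S⟩) :
    evalComp (.letin M N) v =
      QComp.letin (A := ty A) (B := ty B) (evalComp M v) (evalComp N (extend A v)) := by
  rw [evalComp, EffPlusModel.comp]
  exact force_bind _ _ _

theorem evalComp_op (o : {o // o ∈ S.dom}) (V : Val Γ (S.arg o)) :
    evalComp (.op o V) v = QComp.op (S := S.map ty) o (evalVal V v) := by
  rw [evalComp, EffPlusModel.comp]
  exact QVal.force_thunk _

theorem evalComp_handle (M : Comp Γ ⟨A, S⟩) (H : Hdl Γ S C) (N : Comp (A :: Γ) C) :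
    evalComp (.handle M H N) v =
      QComp.handle (S := S.map ty) (evalComp M v)
        (fun o => evalComp (H o) (extend ((S.res o).fn C) (extend (S.arg o) v)))
        (evalComp N (extend A v)) := by
  rw [evalComp, EffPlusModel.comp]
  refine (force_handle _ _ _ _).trans ?_
  exact congrArg (QComp.handle _ · _) (clauses_hdlTuple _ _)

theorem evalComp_case (V : Val Γ (A.sum B)) (M : Comp (A :: Γ) C) (N : Comp (B :: Γ) C) :
    evalComp (.case V M N) v =
      QComp.case (A := ty A) (B := ty B) (evalVal V v) (evalComp M (extend A v))
        (evalComp N (extend B v)) := by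
  rw [evalComp, EffPlusModel.comp]
  exact force_copair _ _ _ _

/-- The substitution `σ` consists of the components of the tuple `v`, up to the identification of a
type with its interpretation. -/
def Represents (v : QVal Δ' ((plusModel Op).ctx Γ)) (σ : QSubst Γ Δ) : Prop :=
  ∀ ⦃A : VTy Op⦄ (x : Var Γ A), TermHom.app ((plusModel Op).var x) v ≍ σ A x

theorem Represents.extend {v : QVal Δ' ((plusModel Op).ctx Γ)} {σ : QSubst Γ Δ}
    (hv : Represents v σ) (hΔ : Δ' = Δ) (A : VTy Op) : Represents (extend A v) (σ.lift A)
  | _, .zero => .trans (heq_of_eq (QVal.snd_pair _ _)) (QVal.var_zero_heq hΔ (ty_eq A))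
  | B, .succ x =>
    have app_fst : TermHom.app ((plusModel Op).var x) (TermHom.extend A v).fst =
        (TermHom.app ((plusModel Op).var x) v).subst (.wk Δ' (ty A)) :=
      (congrArg _ (QVal.fst_pair _ _)).trans (app_subst _ v _).symm
    .trans (heq_of_eq app_fst) (QVal.subst_wk_heq hΔ (ty_eq A) (ty_eq B) (hv x))

theorem exists_represents : ∀ {Γ : Ctx Op} (σ : QSubst Γ Δ),
    ∃ v : QVal Δ ((plusModel Op).ctx Γ), Represents v σ
  | [], _ => ⟨QVal.star, fun _ x => nomatch x⟩
  | A :: Γ, σ => by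
    obtain ⟨v, hv⟩ := exists_represents (Γ := Γ) fun B x => σ B (.succ x)
    let w : QVal Δ (ty A) := cast (congrArg (QVal Δ) (ty_eq A).symm) (σ A .zero)
    refine ⟨v.pair w, fun B x => ?_⟩
    cases x with
    | zero => exact .trans (heq_of_eq (QVal.snd_pair v w)) (cast_heq _ _)
    | succ x =>
      have app_fst := congrArg (TermHom.app ((plusModel Op).var x)) (QVal.fst_pair v w)
      exact .trans (heq_of_eq app_fst) (hv x)

mutual

theorem evalVal_heq : ∀ {Γ Δ Δ' : Ctx Op} {A : VTy Op} (V : Val Γ A)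
    {v : QVal Δ' ((plusModel Op).ctx Γ)} {σ : QSubst Γ Δ}, Represents v σ → Δ' = Δ →
    evalVal V v ≍ V.cls.subst σ
  | _, _, _, _, .var x, _, _, hv, _ => by
    rw [evalVal, EffPlusModel.val, Val.cls_var, QVal.var_subst]
    exact hv x
  | _, _, _, _, .lam M, _, _, hv, hΔ => by
    rw [evalVal_lam, Val.cls_lam, QVal.lam_subst]
    exact QVal.lam_heq hΔ (ty_eq _) (cty_eq _) (evalComp_heq M (hv.extend hΔ _) (by rw [hΔ, ty_eq]))
  | _, _, _, _, .tuple V, _, _, hv, hΔ => by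
    rw [evalVal_tuple, Val.cls_tuple, QVal.tuple_subst]
    exact QVal.tuple_heq hΔ (funext fun _ => ty_eq _) fun i => evalVal_heq (V i) hv hΔ
  | _, _, _, _, .proj (A := F) i V, _, _, hv, hΔ => by
    rw [evalVal_proj, Val.cls_proj, QVal.proj_subst]
    exact QVal.proj_heq hΔ (funext fun _ => ty_eq _) i (evalVal_heq V hv hΔ)
  | _, _, _, _, .inl V, _, _, hv, hΔ => by
    rw [evalVal_inl, Val.cls_inl, QVal.inl_subst]
    exact QVal.inl_heq hΔ (ty_eq _) (ty_eq _) (evalVal_heq V hv hΔ)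
  | _, _, _, _, .inr V, _, _, hv, hΔ => by
    rw [evalVal_inr, Val.cls_inr, QVal.inr_subst]
    exact QVal.inr_heq hΔ (ty_eq _) (ty_eq _) (evalVal_heq V hv hΔ)

theorem evalComp_heq : ∀ {Γ Δ Δ' : Ctx Op} {C : CTy Op} (M : Comp Γ C)
    {v : QVal Δ' ((plusModel Op).ctx Γ)} {σ : QSubst Γ Δ}, Represents v σ → Δ' = Δ →
    evalComp M v ≍ M.cls.subst σ
  | _, _, _, _, .app V W, _, _, hv, hΔ => by
    rw [evalComp_app, Comp.cls_app, QComp.app_subst]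
    exact QComp.app_heq hΔ (ty_eq _) (cty_eq _) (evalVal_heq V hv hΔ) (evalVal_heq W hv hΔ)
  | _, _, _, _, .ret V, _, _, hv, hΔ => by
    rw [evalComp_ret, Comp.cls_ret, QComp.ret_subst]
    exact QComp.ret_heq hΔ (ty_eq _) (sig_map_ty _) (evalVal_heq V hv hΔ)
  | _, _, _, _, .letin M N, _, _, hv, hΔ => by
    rw [evalComp_letin, Comp.cls_letin, QComp.letin_subst]
    exact QComp.letin_heq hΔ (ty_eq _) (ty_eq _) (sig_map_ty _) (evalComp_heq M hv hΔ)
      (evalComp_heq N (hv.extend hΔ _) (by rw [hΔ, ty_eq]))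
  | _, _, _, _, .op o V, _, _, hv, hΔ => by
    rw [evalComp_op, Comp.cls_op, QComp.op_subst]
    exact QComp.op_heq hΔ (sig_map_ty _) rfl (evalVal_heq V hv hΔ)
  | _, Δ, Δ', _, .handle (S := S) (C := C) M H N, _, _, hv, hΔ => by
    rw [evalComp_handle, Comp.cls_handle, QComp.handle_subst]
    refine QComp.handle_heq hΔ (ty_eq _) (sig_map_ty _) (cty_eq _) (evalComp_heq M hv hΔ) ?_
      (evalComp_heq N (hv.extend hΔ _) (by rw [hΔ, ty_eq]))
    intro o o' ho
    obtain rfl : o = o' := Subtype.ext ho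
    have hx : ty (S.arg o) :: Δ' = S.arg o :: Δ := by rw [hΔ, ty_eq]
    have hk : ty ((S.res o).fn C) :: ty (S.arg o) :: Δ' = (S.res o).fn C :: S.arg o :: Δ := by
      rw [hx, ty_eq]
    exact evalComp_heq (H o) ((hv.extend hΔ _).extend hx _) hk
  | _, _, _, _, .case V M N, _, _, hv, hΔ => by
    rw [evalComp_case, Comp.cls_case, QComp.case_subst]
    exact QComp.case_heq hΔ (ty_eq _) (ty_eq _) (cty_eq _) (evalVal_heq V hv hΔ)
      (evalComp_heq M (hv.extend hΔ _) (by rw [hΔ, ty_eq]))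
      (evalComp_heq N (hv.extend hΔ _) (by rw [hΔ, ty_eq]))

end

theorem valEq_of_val_eq {V W : Val Γ A} (h : (plusModel Op).val V = (plusModel Op).val W) :
    ValEq V W := by
  obtain ⟨v, hv⟩ := exists_represents (QSubst.id Γ)
  have hV := evalVal_heq V hv rfl
  have hW := evalVal_heq W hv rfl
  rw [QVal.subst_id] at hV hW
  rw [← Val.cls_eq, ← heq_iff_eq]
  exact hV.symm.trans (.trans (heq_of_eq (by rw [evalVal, h]; rfl)) hW)

theorem compEq_of_comp_eq {M N : Comp Γ C} (h : (plusModel Op).comp M = (plusModel Op).comp N) :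
    CompEq M N := by
  obtain ⟨v, hv⟩ := exists_represents (QSubst.id Γ)
  have hM := evalComp_heq M hv rfl
  have hN := evalComp_heq N hv rfl
  rw [QComp.subst_id] at hM hN
  rw [← Comp.cls_eq, ← heq_iff_eq]
  exact hM.symm.trans (.trans (heq_of_eq (by rw [evalComp, h]; rfl)) hN)

end TermHom

end

end LambdaEff

theorem mainTheorem9 (Op : Type w) :
    -- soundness
    (∀ (C : Type u) [Category.{v} C] [CartesianMonoidalCategory C]
        (𝓜 : LambdaEff.EffPlusModel Op C) (Γ : LambdaEff.Ctx Op),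
      (∀ (A : LambdaEff.VTy Op) (V W : LambdaEff.Val Γ A),
        LambdaEff.ValEq V W → 𝓜.val V = 𝓜.val W) ∧
      (∀ (D : LambdaEff.CTy Op) (M N : LambdaEff.Comp Γ D),
        LambdaEff.CompEq M N → 𝓜.comp M = 𝓜.comp N) ∧
      (∀ (S : LambdaEff.Sig Op (LambdaEff.VTy Op)) (D : LambdaEff.CTy Op)
        (H H' : LambdaEff.Hdl Γ S D),
        LambdaEff.HdlEq H H' → 𝓜.hdl H = 𝓜.hdl H')) ∧
    -- completeness
    (∀ Γ : LambdaEff.Ctx Op,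
      (∀ (A : LambdaEff.VTy Op) (V W : LambdaEff.Val Γ A),
        (∀ (C : Type w) [Category.{w} C] [CartesianMonoidalCategory C]
          (𝓜 : LambdaEff.EffPlusModel Op C), 𝓜.val V = 𝓜.val W) → LambdaEff.ValEq V W) ∧
      (∀ (D : LambdaEff.CTy Op) (M N : LambdaEff.Comp Γ D),
        (∀ (C : Type w) [Category.{w} C] [CartesianMonoidalCategory C]
          (𝓜 : LambdaEff.EffPlusModel Op C), 𝓜.comp M = 𝓜.comp N) → LambdaEff.CompEq M N) ∧
      (∀ (S : LambdaEff.Sig Op (LambdaEff.VTy Op)) (D : LambdaEff.CTy Op)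
        (H H' : LambdaEff.Hdl Γ S D),
        (∀ (C : Type w) [Category.{w} C] [CartesianMonoidalCategory C]
          (𝓜 : LambdaEff.EffPlusModel Op C), 𝓜.hdl H = 𝓜.hdl H') → LambdaEff.HdlEq H H')) := by
  refine ⟨fun C _ _ 𝓜 Γ => ⟨fun _ _ _ => 𝓜.val_eq_of_valEq, fun _ _ _ => 𝓜.comp_eq_of_compEq,
    fun _ _ _ _ => 𝓜.hdl_eq_of_hdlEq⟩,
    fun Γ => ⟨fun _ _ _ h => ?_, fun _ _ _ h => ?_, fun _ _ _ _ h => .congr fun o => ?_⟩⟩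
  · exact LambdaEff.TermHom.valEq_of_val_eq (h _ (LambdaEff.TermHom.plusModel Op))
  · exact LambdaEff.TermHom.compEq_of_comp_eq (h _ (LambdaEff.TermHom.plusModel Op))
  · exact LambdaEff.TermHom.compEq_of_comp_eq
      ((LambdaEff.TermHom.plusModel Op).comp_eq_of_hdl_eq (h _ (LambdaEff.TermHom.plusModel Op)) o)
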